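/- Let $1<p<5$ and $\omega>0$. Let $|D_y|^{s}$ ($s=\tfrac12,1$) be the Fourier multiplier on $\mathbb{R}^2$ with symbol $|\eta|^{s}$, where $\eta$ is the (angular) frequency dual to $y$, so that $|D_y|=\sqrt{-\partial_{yy}}$. Let $$X=\{u\in L^2(\mathbb{R}^2;\mathbb{C}) : \partial_x u\in L^2(\mathbb{R}^2),\ |D_y|^{1/2}u\in L^2(\mathbb{R}^2)\},$$ and for $u\in X$ put $$\mathcal{S}_\omega(u)=\tfrac12\|\partial_x u\|_{L^2}^2+\tfrac12\||D_y|^{1/2}u\|_{L^2}^2+\tfrac{\omega}{2}\|u\|_{L^2}^2-\tfrac1{p+1}\|u\|_{L^{p+1}}^{p+1},$$ $$\mathcal{N}_\omega(u)=\|\partial_x u\|_{L^2}^2+\||D_y|^{1/2}u\|_{L^2}^2+\omega\|u\|_{L^2}^2-\|u\|_{L^{p+1}}^{p+1},$$ $$m_\omega=\inf\{\mathcal{S}_\omega(u) : u\in X\setminus\{0\},\ \mathcal{N}_\omega(u)=0\}.$$ A solution of $$-\partial_{xx}Q+|D_y|Q+\omega Q-|Q|^{p-1}Q=0\quad\text{in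 }\mathbb{R}^2 \qquad (*)$$ is a $Q\in X$ that satisfies $(*)$ weakly, i.e. for every $\varphi\in X$, $$\int_{\mathbb{R}^2}\Big(\partial_xQ\,\overline{\partial_x\varphi}+|D_y|^{1/2}Q\,\overline{|D_y|^{1/2}\varphi}+\omega Q\overline{\varphi}-|Q|^{p-1}Q\overline{\varphi}\Big)\,dx\,dy=0.$$ A ground state is a nonzero solution of $(*)$ at which $\mathcal{S}_\omega$ takes its least value among all nonzero solutions of $(*)$. Theorem. One has $X\subset L^{p+1}(\mathbb{R}^2)$, so that $\mathcal{S}_\omega$ and $\mathcal{N}_\omega$ are finite on $X$, and there exists a ground state $Q_\omega\neq0$ of $(*)$ which attains the infimum $m_\omega$: $\mathcal{N}_\omega(Q_\omega)=0$ and $\mathcal{S}_\omega(Q_\omega)=m_\omega$. -/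

import Mathlib

open MeasureTheory
open scoped FourierTransform ComplexConjugate

noncomputable section

namespace HalfWave

/-- The plane `ℝ²`; the coordinates of a point `z` are `x = z 0` and `y = z 1`. -/
abbrev Plane : Type := EuclideanSpace ℝ (Fin 2)

/-- The complex Hilbert space `L²(ℝ²)` with respect to Lebesgue measure. -/
abbrev L2 : Type := Lp ℂ 2 (volume : Measure Plane)

/-- The Fourier symbol of `∂ₓ`. The Fourier transform is normalised as
`û(ξ) = ∫ exp(-2πi z·ξ) u(z) dz`. -/
def symbolDx (ξ : Plane) : ℂ := 2 * Real.pi * Complex.I * (ξ 0 : ℝ)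

/-- The Fourier symbol of `|D_y|^{1/2}`, where `|D_y| = √(-∂_yy)` has the symbol `2π|ξ₁|`. -/
def symbolHalfDy (ξ : Plane) : ℂ := (Real.sqrt (2 * Real.pi * |ξ 1|) : ℝ)

/-- The functions of `L²(ℝ²)` whose image under the Fourier multiplier with symbol `m`
lies in `L²(ℝ²)`. -/
def multiplierDomain (m : Plane → ℂ) : Submodule ℂ L2 where
  carrier := {u | MemLp (fun ξ => m ξ * (𝓕 u : L2) ξ) 2 volume}
  zero_mem' := by
    have h : 𝓕 (0 : L2) = 0 := map_zero (Lp.fourierTransformₗᵢ Plane ℂ)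
    refine (memLp_congr_ae ?_).2 (MemLp.zero : MemLp (0 : Plane → ℂ) 2 volume)
    rw [h]
    filter_upwards [Lp.coeFn_zero ℂ 2 (volume : Measure Plane)] with ξ hξ
    rw [hξ]; simp
  add_mem' := by
    intro u v hu hv
    have h : 𝓕 (u + v) = 𝓕 u + 𝓕 v := map_add (Lp.fourierTransformₗᵢ Plane ℂ) u v
    refine (memLp_congr_ae ?_).2 (MemLp.add hu hv)
    rw [h]
    filter_upwards [Lp.coeFn_add (𝓕 u : L2) (𝓕 v : L2)] with ξ hξ
    simp only [hξ, Pi.add_apply, mul_add]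
  smul_mem' := by
    intro c u hu
    have h : 𝓕 (c • u) = c • 𝓕 u := map_smul (Lp.fourierTransformₗᵢ Plane ℂ) c u
    refine (memLp_congr_ae ?_).2 (MemLp.const_smul hu c)
    rw [h]
    filter_upwards [Lp.coeFn_smul c (𝓕 u : L2)] with ξ hξ
    simp only [hξ, Pi.smul_apply, smul_eq_mul]
    ring

/-- The Fourier multiplier with symbol `m`, as an operator on its domain in `L²(ℝ²)`. -/
def multiplier (m : Plane → ℂ) (u : multiplierDomain m) : L2 :=
  𝓕⁻ (MemLp.toLp (fun ξ => m ξ * (𝓕 (u : L2) : L2) ξ) u.2)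

/-- The energy space `X = H¹ₓL²_y(ℝ²) ∩ L²ₓH^{1/2}_y(ℝ²)`: the `u ∈ L²(ℝ²)` with
`∂ₓu ∈ L²(ℝ²)` and `|D_y|^{1/2}u ∈ L²(ℝ²)`. -/
def energySpace : Submodule ℂ L2 :=
  multiplierDomain symbolDx ⊓ multiplierDomain symbolHalfDy

/-- `∂ₓu` for `u ∈ X`. -/
def dx (u : energySpace) : L2 := multiplier symbolDx ⟨u, u.2.1⟩

/-- `|D_y|^{1/2}u` for `u ∈ X`. -/
def halfDy (u : energySpace) : L2 := multiplier symbolHalfDy ⟨u, u.2.2⟩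

/-- `‖u‖_{L^{p+1}}^{p+1}`. -/
def potential (p : ℝ) (u : energySpace) : ℝ := ∫ z : Plane, ‖(u : L2) z‖ ^ (p + 1)

/-- The action
`S_ω(u) = ½‖∂ₓu‖² + ½‖|D_y|^{1/2}u‖² + (ω/2)‖u‖² - (1/(p+1))‖u‖_{L^{p+1}}^{p+1}`. -/
def action (p ω : ℝ) (u : energySpace) : ℝ :=
  1 / 2 * ‖dx u‖ ^ 2 + 1 / 2 * ‖halfDy u‖ ^ 2 + ω / 2 * ‖(u : L2)‖ ^ 2
    - 1 / (p + 1) * potential p u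

/-- The Nehari functional
`N_ω(u) = ‖∂ₓu‖² + ‖|D_y|^{1/2}u‖² + ω‖u‖² - ‖u‖_{L^{p+1}}^{p+1}`. -/
def nehari (p ω : ℝ) (u : energySpace) : ℝ :=
  ‖dx u‖ ^ 2 + ‖halfDy u‖ ^ 2 + ω * ‖(u : L2)‖ ^ 2 - potential p u

/-- The Nehari manifold `{u ∈ X ∖ {0} | N_ω(u) = 0}`. -/
def nehariManifold (p ω : ℝ) : Set energySpace := {u | u ≠ 0 ∧ nehari p ω u = 0}

/-- `m_ω = inf {S_ω(u) | u ∈ X ∖ {0}, N_ω(u) = 0}`. -/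
def minLevel (p ω : ℝ) : ℝ := sInf (action p ω '' nehariManifold p ω)

/-- `Q ∈ X` is a (weak) solution of `-∂ₓₓQ + |D_y|Q + ωQ - |Q|^{p-1}Q = 0`: the equation holds
in the dual of `X`, that is, after pairing in `L²` with every `φ ∈ X`. (In Mathlib
`inner ℂ f g` is `∫ conj f * g`.) -/
def IsSolution (p ω : ℝ) (Q : energySpace) : Prop :=
  ∀ φ : energySpace,
    inner ℂ (dx φ) (dx Q) + inner ℂ (halfDy φ) (halfDy Q) + ω * inner ℂ (φ : L2) (Q : L2)
      - ∫ z : Plane, ((‖(Q : L2) z‖ ^ (p - 1) : ℝ) : ℂ) * (Q : L2) z * conj ((φ : L2) z) = 0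

/-- A ground state is a non-trivial solution that minimizes the action among all non-trivial
solutions. -/
def IsGroundState (p ω : ℝ) (Q : energySpace) : Prop :=
  (Q ≠ 0 ∧ IsSolution p ω Q) ∧
    ∀ u : energySpace, u ≠ 0 → IsSolution p ω u → action p ω Q ≤ action p ω u

end HalfWave

end

/-! The multiplier `weight ω ^ (-1/2)`, composed with the inverse Fourier transform, carries `L²`
isometrically onto `X` with squared norm `‖∂ₓu‖² + ‖|D_y|^{1/2}u‖² + ω‖u‖²` (`toEnergy_surjective`,
`inner_toEnergy`). With `q = p + 1`, the action of `toEnergy hω f` is `½‖f‖² - power hω q f / q` and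
its Nehari functional is `‖f‖² - power hω q f`. The problem thus becomes the attainment of the best
constant `M` in `power hω q f ≤ M ‖f‖^q`. An extremizer `g` scaled so that `M ‖g‖^(q-2) = 1` has
least norm on the Nehari manifold, hence least action, and its first-order condition is the equation
(`inner_eq_integral_nonlinearity`).

The inequality holds because `{weight ω < ρ}` has volume at most `ρ^{3/2}`: Bernstein's inequality
on the band `R ≤ weight ω < 2R` yields a factor `R ^ (-gain q)`, and `gain q > 0` for `q < 6`, so
the dyadic sum is geometric.

Attainment (`exists_extremizer`) has to overcome translation invariance. High frequencies contribute
uniformly little to the `L^q` norm, so the low-frequency part of a maximizing sequence is bounded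
below at some point; after translating that point to the origin, a weak limit `g` is nonzero. Weak
convergence also gives almost everywhere convergence along a subsequence, and half of the
Brezis–Lieb lemma yields `M ≤ M (1 - ‖g‖²)^{q/2} + power hω q g`. Since `q/2 ≥ 1` and `0 < ‖g‖ ≤ 1`,
no mass can be split off without loss and `g` is an extremizer. -/

noncomputable section

namespace HalfWave

open Filter Topology
open scoped ENNReal SchwartzMap

/-! ### The inverse Fourier transform on `L²` -/

/-- On `L¹ ∩ L²` the inverse Fourier transform of `L²` is given by the integral. -/
theorem fourierInv_coeFn_of_integrable (f : L2) (hf : Integrable f) :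
    ((𝓕⁻ f : L2) : Plane → ℂ) =ᵐ[volume] 𝓕⁻ (f : Plane → ℂ) := by
  have hcont : Continuous (𝓕⁻ (f : Plane → ℂ)) := by
    rw [Real.fourierInv_eq_fourier_comp_neg]
    exact VectorFourier.fourierIntegral_continuous Real.continuous_fourierChar
      continuous_inner hf.comp_neg
  -- Both sides are tested against smooth compactly supported functions. On the left the transform
  -- moves to the test function by compatibility with tempered distributions, on the right by
  -- Fubini.
  refine ae_eq_of_integral_contDiff_smul_eq
    ((Lp.memLp (𝓕⁻ f : L2)).locallyIntegrable (by norm_num)) hcont.locallyIntegrable ?_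
  intro g hg hgc
  let φ : 𝓢(Plane, ℂ) := HasCompactSupport.toSchwartzMap (f := fun x => (g x : ℂ))
    (hgc.comp_left (g := fun t : ℝ => (t : ℂ)) (by simp))
    (Complex.ofRealCLM.contDiff.comp hg)
  have hφ : ∀ x, φ x = (g x : ℂ) := fun x => rfl
  have h1 := congrArg (fun T : 𝓢'(Plane, ℂ) => T φ)
    (Lp.fourierInv_toTemperedDistribution_eq f)
  simp only [TemperedDistribution.fourierInv_apply, Lp.toTemperedDistribution_apply] at h1
  have h2 := VectorFourier.integral_fourierIntegral_smul_eq_flip (L := -innerₗ Plane)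
      (μ := volume) (ν := volume) Real.continuous_fourierChar
      (continuous_inner (𝕜 := ℝ) (E := Plane)).neg φ.integrable hf
  have hL : (-innerₗ Plane).flip = -innerₗ Plane := by
    ext x y; simp [real_inner_comm]
  rw [hL] at h2
  have h4 : ∀ (h : Plane → ℂ), VectorFourier.fourierIntegral Real.fourierChar volume
      (-innerₗ Plane) h = 𝓕⁻ h := fun h => by
    ext z
    simp [VectorFourier.fourierIntegral, Real.fourierInv_eq]
  rw [h4, h4] at h2
  have h3 : ∀ x, (𝓕⁻ φ) x = 𝓕⁻ (φ : Plane → ℂ) x := fun x => by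
    rw [SchwartzMap.fourierInv_coe]
  simp only [h3, hφ] at h1
  have e : ∀ (g : Plane → ℝ) (h : Plane → ℂ), (fun x => g x • h x) = fun x => (g x : ℂ) • h x :=
    fun _ _ => by ext; simp
  rw [e, e, ← h1]
  exact h2

/-- The character `ξ ↦ exp (2πi ⟪ξ, a⟫)`. -/
def character (a ξ : Plane) : ℂ := (Real.fourierChar (inner ℝ ξ a) : ℂ)

theorem norm_character (a ξ : Plane) : ‖character a ξ‖ = 1 := by
  exact Circle.norm_coe _

theorem continuous_character (a : Plane) : Continuous (character a) := by
  unfold character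
  have := Real.continuous_fourierChar
  fun_prop

theorem fourierInv_eq_integral_character (f : Plane → ℂ) (z : Plane) :
    𝓕⁻ f z = ∫ ξ, character z ξ * f ξ := by
  simp [Real.fourierInv_eq, character, Circle.smul_def]

/-- Multiplication by an essentially bounded function, as a bounded operator on `L²`. -/
def mulOp {m : Plane → ℂ} (hm : MemLp m ∞ volume) : L2 →L[ℂ] L2 :=
  (ContinuousLinearMap.mul ℂ ℂ).holderL volume ∞ 2 2 hm.toLp

theorem mulOp_coeFn {m : Plane → ℂ} (hm : MemLp m ∞ volume) (f : L2) :
    (mulOp hm f : Plane → ℂ) =ᵐ[volume] fun ξ => m ξ * f ξ := by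
  have h := (ContinuousLinearMap.mul ℂ ℂ).coeFn_holder (r := 2) (hm.toLp m) f
  filter_upwards [h, hm.coeFn_toLp] with ξ h1 h2
  rw [← h2]
  exact h1

theorem memLp_character (a : Plane) : MemLp (character a) ∞ volume :=
  memLp_top_of_bound (continuous_character a).aestronglyMeasurable 1
    (.of_forall fun ξ => (norm_character a ξ).le)

/-- Modulation of `f` by a character. -/
def modulate (a : Plane) : L2 →L[ℂ] L2 := mulOp (memLp_character a)

theorem norm_modulate (a : Plane) (f : L2) : ‖modulate a f‖ = ‖f‖ := by
  rw [Lp.norm_def, Lp.norm_def]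
  congr 1
  refine eLpNorm_congr_norm_ae ?_
  filter_upwards [mulOp_coeFn (memLp_character a) f] with ξ h
  rw [modulate, h, norm_mul, norm_character, one_mul]

theorem character_add (a b ξ : Plane) : character (a + b) ξ = character a ξ * character b ξ := by
  simp [character, inner_add_right, AddChar.map_add_eq_mul]

/-- The inverse Fourier transform turns modulations into translations. -/
theorem fourierInv_modulate (a : Plane) (f : L2) :
    ((𝓕⁻ (modulate a f) : L2) : Plane → ℂ) =ᵐ[volume] fun z => (𝓕⁻ f : L2) (z + a) := by
  have hmp : MeasurePreserving (fun z : Plane => z + a) volume volume :=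
    measurePreserving_add_right volume a
  suffices h : (𝓕⁻ (modulate a f) : L2) = Lp.compMeasurePreserving _ hmp (𝓕⁻ f : L2) by
    rw [h]
    exact Lp.coeFn_compMeasurePreserving _ hmp
  -- Both sides are continuous in `f`, so Schwartz functions suffice; for these the integral formula
  -- applies.
  refine DenseRange.induction_on (p := fun f : L2 =>
      (𝓕⁻ (modulate a f) : L2) = Lp.compMeasurePreserving _ hmp (𝓕⁻ f : L2))
    (SchwartzMap.denseRange_toLpCLM (F := ℂ) (E := Plane) (μ := volume) (p := 2)
      ENNReal.ofNat_ne_top) f ?_ ?_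
  · apply isClosed_eq
    · exact (FourierTransform.continuous_fourierInv).comp (modulate a).continuous
    · exact (Lp.isometry_compMeasurePreserving hmp).continuous.comp
        FourierTransform.continuous_fourierInv
  · intro φ
    set g : L2 := φ.toLp 2 volume with hg
    change (𝓕⁻ (modulate a g) : L2) = Lp.compMeasurePreserving _ hmp (𝓕⁻ g : L2)
    have hgi : Integrable g := φ.integrable.congr (φ.coeFn_toLp 2 volume).symm
    have hmg := mulOp_coeFn (memLp_character a) g
    have hmi : Integrable (modulate a g) :=
      (hgi.bdd_mul (continuous_character a).aestronglyMeasurable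
        (.of_forall fun ξ => (norm_character a ξ).le)).congr hmg.symm
    apply Lp.ext
    refine (fourierInv_coeFn_of_integrable _ hmi).trans ?_
    refine EventuallyEq.trans ?_ (Lp.coeFn_compMeasurePreserving _ hmp).symm
    refine EventuallyEq.trans ?_
      (hmp.quasiMeasurePreserving.ae_eq_comp (fourierInv_coeFn_of_integrable g hgi)).symm
    refine .of_forall fun z => ?_
    simp only [Function.comp_apply, fourierInv_eq_integral_character]
    refine integral_congr_ae ?_
    filter_upwards [hmg] with ξ h
    rw [modulate, h, character_add]
    ring

/-! ### Frequency-localised synthesis operators -/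

/-- The symbol `(2πξ₀)² + 2π|ξ₁| + ω` of `-∂ₓₓ + |D_y| + ω`. -/
def weight (ω : ℝ) (ξ : Plane) : ℝ := (2 * Real.pi * ξ 0) ^ 2 + 2 * Real.pi * |ξ 1| + ω

theorem le_weight (ω : ℝ) (ξ : Plane) : ω ≤ weight ω ξ := by
  unfold weight
  have := Real.pi_pos
  have : 0 ≤ (2 * Real.pi * ξ 0) ^ 2 + 2 * Real.pi * |ξ 1| := by positivity
  linarith

theorem continuous_weight (ω : ℝ) : Continuous (weight ω) := by
  unfold weight
  fun_prop

/-- The sublevel set `{weight ω < ρ}` has volume at most `ρ^{3/2}`. -/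
theorem volume_weight_lt_le {ω : ℝ} (hω : 0 < ω) {ρ : ℝ} (hρ : 0 ≤ ρ) :
    volume {ξ | weight ω ξ < ρ} ≤ ENNReal.ofReal (ρ * √ρ) := by
  have hpi := Real.pi_gt_three
  -- `weight ω ξ < ρ` bounds `(2πξ₀)²` and `2π|ξ₁|` by `ρ`, and `π > 1`; the resulting box has area
  -- `√ρ · ρ`.
  let r : Fin 2 → ℝ := ![√ρ / 2, ρ / 2]
  have hsub : {ξ | weight ω ξ < ρ} ⊆
      (@WithLp.ofLp 2 (Fin 2 → ℝ)) ⁻¹' Set.Icc (-r) r := by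
    intro ξ hξ
    simp only [Set.mem_ofPred_eq, weight] at hξ
    have h1 : |ξ 1| ≤ ρ / 2 := by
      have : 0 ≤ (2 * Real.pi * ξ 0) ^ 2 := by positivity
      nlinarith [abs_nonneg (ξ 1)]
    have h0 : |ξ 0| ≤ √ρ / 2 := by
      have h2 : 0 ≤ 2 * Real.pi * |ξ 1| := by positivity
      have h3 : (2 * |ξ 0|) ^ 2 ≤ ρ := by
        rw [mul_pow, sq_abs]
        nlinarith [sq_nonneg (ξ 0), mul_nonneg (sq_nonneg (ξ 0)) (show 0 ≤ Real.pi ^ 2 - 1 by nlinarith)]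
      have := Real.le_sqrt_of_sq_le h3
      linarith
    rw [Set.mem_preimage, Set.mem_Icc, Pi.le_def, Pi.le_def, Fin.forall_fin_two, Fin.forall_fin_two]
    have a0 := abs_le.1 h0
    have a1 := abs_le.1 h1
    exact ⟨⟨a0.1, a1.1⟩, ⟨a0.2, a1.2⟩⟩
  refine (measure_mono hsub).trans ?_
  rw [(PiLp.volume_preserving_ofLp (Fin 2)).measure_preimage
    measurableSet_Icc.nullMeasurableSet, Real.volume_Icc_pi, Fin.prod_univ_two,
    ← ENNReal.ofReal_mul (by simp [r])]
  apply ENNReal.ofReal_le_ofReal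
  simp [r]
  nlinarith [mul_nonneg hρ (Real.sqrt_nonneg ρ)]

/-- The symbol `weight ω ^ (-1/2)` localised to the set `S` of frequencies. -/
def localSymbol (ω : ℝ) (S : Set Plane) : Plane → ℂ :=
  S.indicator fun ξ => ((√(weight ω ξ))⁻¹ : ℝ)

theorem measurable_localSymbol (ω : ℝ) {S : Set Plane} (hS : MeasurableSet S) :
    Measurable (localSymbol ω S) := by
  refine Measurable.indicator ?_ hS
  have := (continuous_weight ω).measurable
  fun_prop

theorem norm_localSymbol_le (ω : ℝ) {S : Set Plane} {R : ℝ} (hR : 0 < R)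
    (h : ∀ ξ ∈ S, R ≤ weight ω ξ) (ξ : Plane) : ‖localSymbol ω S ξ‖ ≤ (√R)⁻¹ := by
  by_cases hξ : ξ ∈ S
  · rw [localSymbol, Set.indicator_of_mem hξ, Complex.norm_real, Real.norm_of_nonneg (by positivity)]
    have := h ξ hξ
    gcongr
  · rw [localSymbol, Set.indicator_of_notMem hξ, norm_zero]
    positivity

theorem memLp_localSymbol {ω : ℝ} (hω : 0 < ω) {S : Set Plane} (hS : MeasurableSet S) :
    MemLp (localSymbol ω S) ∞ volume :=
  memLp_top_of_bound (measurable_localSymbol ω hS).aestronglyMeasurable _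
    (.of_forall (norm_localSymbol_le ω hω fun ξ _ => le_weight ω ξ))

/-- The Fourier multiplier `f ↦ 𝓕⁻ (1_S · weight ω ^ (-1/2) · f)`. -/
def synth {ω : ℝ} (hω : 0 < ω) {S : Set Plane} (hS : MeasurableSet S) : L2 →L[ℂ] L2 :=
  (Lp.fourierTransformₗᵢ Plane ℂ).symm.toContinuousLinearEquiv.toContinuousLinearMap ∘L
    mulOp (memLp_localSymbol hω hS)

theorem synth_apply {ω : ℝ} (hω : 0 < ω) {S : Set Plane} (hS : MeasurableSet S) (f : L2) :
    synth hω hS f = 𝓕⁻ (mulOp (memLp_localSymbol hω hS) f) := rfl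

theorem norm_fourierInv (f : L2) : ‖(𝓕⁻ f : L2)‖ = ‖f‖ :=
  (Lp.fourierTransformₗᵢ Plane ℂ).symm.norm_map f

theorem norm_synth_le {ω : ℝ} (hω : 0 < ω) {S : Set Plane} (hS : MeasurableSet S) {R : ℝ}
    (hR : 0 < R) (h : ∀ ξ ∈ S, R ≤ weight ω ξ) (f : L2) :
    ‖synth hω hS f‖ ≤ (√R)⁻¹ * ‖f‖ := by
  rw [synth_apply, norm_fourierInv]
  refine Lp.norm_le_mul_norm_of_ae_le_mul ?_
  filter_upwards [mulOp_coeFn (memLp_localSymbol hω hS) f] with ξ hξ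
  rw [hξ, norm_mul]
  gcongr
  exact norm_localSymbol_le ω hR h ξ

theorem synth_union {ω : ℝ} (hω : 0 < ω) {S T : Set Plane} (hS : MeasurableSet S)
    (hT : MeasurableSet T) (hST : Disjoint S T) (f : L2) :
    synth hω (hS.union hT) f = synth hω hS f + synth hω hT f := by
  simp only [synth_apply]
  rw [← FourierTransform.fourierInv_add]
  congr 1
  apply Lp.ext
  filter_upwards [mulOp_coeFn (memLp_localSymbol hω hS) f,
    mulOp_coeFn (memLp_localSymbol hω hT) f, mulOp_coeFn (memLp_localSymbol hω (hS.union hT)) f,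
    Lp.coeFn_add (mulOp (memLp_localSymbol hω hS) f) (mulOp (memLp_localSymbol hω hT) f)]
    with ξ h1 h2 h3 h4
  rw [h3, h4, Pi.add_apply, h1, h2, localSymbol, Set.indicator_union_of_disjoint hST, add_mul]
  rfl

theorem synth_congr {ω : ℝ} (hω : 0 < ω) {S T : Set Plane} (hS : MeasurableSet S)
    (hT : MeasurableSet T) (hST : S = T) : synth hω hS = synth hω hT := by
  subst hST; rfl

/-- Translations of the synthesised function correspond to modulations. -/
theorem synth_modulate {ω : ℝ} (hω : 0 < ω) {S : Set Plane} (hS : MeasurableSet S)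
    (a : Plane) (f : L2) :
    (synth hω hS (modulate a f) : Plane → ℂ) =ᵐ[volume] fun z => synth hω hS f (z + a) := by
  have h : mulOp (memLp_localSymbol hω hS) (modulate a f) =
      modulate a (mulOp (memLp_localSymbol hω hS) f) := by
    apply Lp.ext
    filter_upwards [mulOp_coeFn (memLp_localSymbol hω hS) f,
      mulOp_coeFn (memLp_localSymbol hω hS) (modulate a f),
      mulOp_coeFn (memLp_character a) f,
      mulOp_coeFn (memLp_character a) (mulOp (memLp_localSymbol hω hS) f)] with ξ h1 h2 h3 h4
    rw [h2, modulate, h3, h4, h1]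
    ring
  rw [synth_apply, h]
  exact fourierInv_modulate a _

theorem measurableSet_weight (ω : ℝ) {I : Set ℝ} (hI : MeasurableSet I) :
    MeasurableSet (weight ω ⁻¹' I) := (continuous_weight ω).measurable hI

/-- The kernel representing the evaluation at `z` of the synthesis operator. -/
def kernelFun (ω : ℝ) (S : Set Plane) (z ξ : Plane) : ℂ :=
  localSymbol ω S ξ * conj (character z ξ)

theorem norm_kernelFun (ω : ℝ) (S : Set Plane) (z ξ : Plane) :
    ‖kernelFun ω S z ξ‖ = ‖localSymbol ω S ξ‖ := by
  rw [kernelFun, norm_mul, RCLike.norm_conj, norm_character, mul_one]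

theorem eLpNorm_kernelFun_le {ω : ℝ} {S : Set Plane}
    {R : ℝ} (hR : 0 < R) (h : ∀ ξ ∈ S, R ≤ weight ω ξ) (hS : MeasurableSet S) (z : Plane) :
    eLpNorm (kernelFun ω S z) 2 volume ≤ ENNReal.ofReal (√R)⁻¹ * volume S ^ (1 / 2 : ℝ) := by
  have h1 : eLpNorm (kernelFun ω S z) 2 volume ≤
      eLpNorm (S.indicator fun _ => (√R)⁻¹) 2 volume := by
    refine eLpNorm_mono fun ξ => ?_
    rw [norm_kernelFun]
    by_cases hξ : ξ ∈ S
    · rw [Set.indicator_of_mem hξ, Real.norm_of_nonneg (by positivity)]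
      exact norm_localSymbol_le ω hR h ξ
    · rw [localSymbol, Set.indicator_of_notMem hξ, Set.indicator_of_notMem hξ, norm_zero, norm_zero]
  refine h1.trans ?_
  rw [eLpNorm_indicator_const hS (by norm_num) (by norm_num), Real.enorm_of_nonneg (by positivity)]
  simp

theorem memLp_kernelFun {ω : ℝ} (hω : 0 < ω) {S : Set Plane} (hS : MeasurableSet S)
    (hfin : volume S ≠ ∞) (z : Plane) : MemLp (kernelFun ω S z) 2 volume := by
  refine ⟨((measurable_localSymbol ω hS).mul
    (Complex.continuous_conj.comp (continuous_character z)).measurable).aestronglyMeasurable, ?_⟩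
  refine (eLpNorm_kernelFun_le hω (fun ξ _ => le_weight ω ξ) hS z).trans_lt ?_
  exact ENNReal.mul_lt_top ENNReal.ofReal_lt_top
    (ENNReal.rpow_lt_top_of_nonneg (by norm_num) hfin)

/-- The kernel as an element of `L²`. -/
def kernel {ω : ℝ} (hω : 0 < ω) {S : Set Plane} (hS : MeasurableSet S)
    (hfin : volume S ≠ ∞) (z : Plane) : L2 := (memLp_kernelFun hω hS hfin z).toLp

theorem norm_kernel_le {ω : ℝ} (hω : 0 < ω) {S : Set Plane} (hS : MeasurableSet S)
    (hfin : volume S ≠ ∞) {R : ℝ} (hR : 0 < R) (h : ∀ ξ ∈ S, R ≤ weight ω ξ) (z : Plane) :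
    ‖kernel hω hS hfin z‖ ≤ (√R)⁻¹ * √(volume S).toReal := by
  rw [kernel, Lp.norm_toLp]
  refine (ENNReal.toReal_mono ?_ (eLpNorm_kernelFun_le hR h hS z)).trans_eq ?_
  · exact ENNReal.mul_ne_top ENNReal.ofReal_ne_top
      (ENNReal.rpow_ne_top_of_nonneg (by norm_num) hfin)
  · rw [ENNReal.toReal_mul, ENNReal.toReal_ofReal (by positivity), ← ENNReal.toReal_rpow,
      Real.sqrt_eq_rpow (volume S).toReal]

theorem inner_kernel {ω : ℝ} (hω : 0 < ω) {S : Set Plane} (hS : MeasurableSet S)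
    (hfin : volume S ≠ ∞) (z : Plane) (f : L2) :
    inner ℂ (kernel hω hS hfin z) f = ∫ ξ, character z ξ * (localSymbol ω S ξ * f ξ) := by
  rw [L2.inner_def]
  refine integral_congr_ae ?_
  filter_upwards [(memLp_kernelFun hω hS hfin z).coeFn_toLp] with ξ h
  rw [kernel, h, RCLike.inner_apply, kernelFun, map_mul, RCLike.conj_conj]
  have : conj (localSymbol ω S ξ) = localSymbol ω S ξ := by
    unfold localSymbol
    by_cases hξ : ξ ∈ S
    · rw [Set.indicator_of_mem hξ, Complex.conj_ofReal]
    · rw [Set.indicator_of_notMem hξ, map_zero]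
  rw [this]
  ring

/-- On a set of finite volume the symbol is square integrable, so `localSymbol ω S · f` is
integrable by Cauchy–Schwarz and the inverse transform is a genuine integral. This makes point
evaluation a bounded functional, to which weak convergence applies. -/
theorem synth_eq_inner_kernel {ω : ℝ} (hω : 0 < ω) {S : Set Plane} (hS : MeasurableSet S)
    (hfin : volume S ≠ ∞) (f : L2) :
    (synth hω hS f : Plane → ℂ) =ᵐ[volume] fun z => inner ℂ (kernel hω hS hfin z) f := by
  have hm := mulOp_coeFn (memLp_localSymbol hω hS) f
  have hint : Integrable (mulOp (memLp_localSymbol hω hS) f) := by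
    have h1 : Integrable fun ξ => ‖kernelFun ω S 0 ξ‖ * ‖f ξ‖ :=
      (memLp_kernelFun hω hS hfin 0).norm.integrable_mul (Lp.memLp f).norm
    refine h1.mono' (Lp.aestronglyMeasurable _) ?_
    filter_upwards [hm] with ξ h
    rw [h, norm_mul, norm_kernelFun]
  rw [synth_apply]
  refine (fourierInv_coeFn_of_integrable _ hint).trans (.of_forall fun z => ?_)
  simp only [inner_kernel, fourierInv_eq_integral_character]
  refine integral_congr_ae ?_
  filter_upwards [hm] with ξ h
  rw [h]

theorem continuous_inner_kernel {ω : ℝ} (hω : 0 < ω) {S : Set Plane} (hS : MeasurableSet S)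
    (hfin : volume S ≠ ∞) (f : L2) : Continuous fun z => inner ℂ (kernel hω hS hfin z) f := by
  have h1 : Integrable fun ξ => ‖kernelFun ω S 0 ξ‖ * ‖f ξ‖ :=
    (memLp_kernelFun hω hS hfin 0).norm.integrable_mul (Lp.memLp f).norm
  simp only [inner_kernel]
  refine continuous_of_dominated (fun z => ?_) (fun z => .of_forall fun ξ => ?_) h1
    (.of_forall fun ξ => ?_)
  · exact (continuous_character z).aestronglyMeasurable.mul
      ((measurable_localSymbol ω hS).aestronglyMeasurable.mul (Lp.aestronglyMeasurable f))
  · rw [norm_mul, norm_mul, norm_character, one_mul, norm_kernelFun]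
  · have := Real.continuous_fourierChar
    unfold character
    fun_prop

/-! ### The anisotropic Sobolev embedding -/

/-- Interpolation between `L²` and `L^∞`. -/
theorem eLpNorm_le_of_bound_of_eLpNorm_two {α E : Type*} [MeasurableSpace α] {μ : Measure α}
    [NormedAddCommGroup E] {g : α → E} {q : ℝ} (hq : 2 ≤ q) {A B : ℝ} (hA : 0 ≤ A) (hB : 0 ≤ B)
    (hbound : ∀ᵐ x ∂μ, ‖g x‖ ≤ B) (htwo : eLpNorm g 2 μ ≤ ENNReal.ofReal A) :
    eLpNorm g (ENNReal.ofReal q) μ ≤ ENNReal.ofReal (B ^ (1 - 2 / q) * A ^ (2 / q)) := by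
  have hq0 : 0 < q := by linarith
  have h1 : eLpNorm g (ENNReal.ofReal q) μ ≤
      ENNReal.ofReal (B ^ (1 - 2 / q)) *
        eLpNorm (fun x => ‖g x‖ ^ (2 / q)) (ENNReal.ofReal q) μ := by
    refine eLpNorm_le_mul_eLpNorm_of_ae_le_mul ?_ _
    filter_upwards [hbound] with x hx
    rw [Real.norm_of_nonneg (by positivity)]
    calc ‖g x‖ = ‖g x‖ ^ (1 - 2 / q) * ‖g x‖ ^ (2 / q) := by
          rw [← Real.rpow_add' (norm_nonneg _) (by simp)]
          simp
      _ ≤ _ := by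
          gcongr
          rw [sub_nonneg, div_le_one hq0]
          exact hq
  refine h1.trans ?_
  rw [eLpNorm_norm_rpow _ (by positivity), ← ENNReal.ofReal_mul hq0.le,
    show q * (2 / q) = 2 by field_simp, ENNReal.ofReal_mul (by positivity),
    ← ENNReal.ofReal_rpow_of_nonneg hA (by positivity)]
  gcongr
  simpa using htwo

/-- The frequency region `{R ≤ weight ω < ρ}`. -/
abbrev band (ω R ρ : ℝ) : Set Plane := weight ω ⁻¹' Set.Ico R ρ

theorem measurableSet_band (ω R ρ : ℝ) : MeasurableSet (band ω R ρ) :=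
  measurableSet_weight ω measurableSet_Ico

theorem volume_band_le {ω : ℝ} (hω : 0 < ω) (R : ℝ) {ρ : ℝ} (hρ : 0 ≤ ρ) :
    volume (band ω R ρ) ≤ ENNReal.ofReal (ρ * √ρ) :=
  (measure_mono fun _ h => h.2).trans (volume_weight_lt_le hω hρ)

theorem volume_band_ne_top {ω : ℝ} (hω : 0 < ω) (R : ℝ) {ρ : ℝ} (hρ : 0 ≤ ρ) :
    volume (band ω R ρ) ≠ ∞ :=
  ((volume_band_le hω R hρ).trans_lt ENNReal.ofReal_lt_top).ne

/-- Evaluation at a point is bounded on functions with frequencies in a band. -/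
theorem norm_kernel_band_le {ω : ℝ} (hω : 0 < ω) {R ρ : ℝ} (hR : 0 < R) (hρ : 0 ≤ ρ) (z : Plane) :
    ‖kernel hω (measurableSet_band ω R ρ) (volume_band_ne_top hω R hρ) z‖ ≤
      (√R)⁻¹ * √(ρ * √ρ) := by
  refine (norm_kernel_le hω _ _ hR (fun ξ h => h.1) z).trans ?_
  gcongr
  exact ENNReal.toReal_le_of_le_ofReal (by positivity) (volume_band_le hω R hρ)

theorem ae_norm_synth_band_le {ω : ℝ} (hω : 0 < ω) {R ρ : ℝ} (hR : 0 < R) (hρ : 0 ≤ ρ) (f : L2) :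
    ∀ᵐ z : Plane, ‖synth hω (measurableSet_band ω R ρ) f z‖ ≤ (√R)⁻¹ * √(ρ * √ρ) * ‖f‖ := by
  filter_upwards [synth_eq_inner_kernel hω (measurableSet_band ω R ρ)
    (volume_band_ne_top hω R hρ) f] with z hz
  rw [hz]
  refine (norm_inner_le_norm _ _).trans ?_
  gcongr
  exact norm_kernel_band_le hω hR hρ z

theorem eLpNorm_le_ofReal_of_norm_le {f : L2} {A : ℝ} (h : ‖f‖ ≤ A) :
    eLpNorm f 2 volume ≤ ENNReal.ofReal A := by
  rw [← Lp.enorm_def, ← ofReal_norm]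
  exact ENNReal.ofReal_le_ofReal h

/-- The gain `3/(2q) - 1/4` of the embedding into `L^q`; it is positive for `0 < q < 6`. -/
def gain (q : ℝ) : ℝ := 3 / (2 * q) - 1 / 4

theorem gain_pos {q : ℝ} (hq : 0 < q) (hq6 : q < 6) : 0 < gain q := by
  unfold gain
  rw [sub_pos, div_lt_div_iff₀ (by norm_num) (by positivity)]
  linarith

/-- Bernstein's inequality on a dyadic band. -/
theorem eLpNorm_synth_dyadic_le {ω : ℝ} (hω : 0 < ω) {q : ℝ} (hq : 2 ≤ q) {R : ℝ} (hR : 0 < R)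
    (f : L2) :
    eLpNorm (synth hω (measurableSet_band ω R (2 * R)) f) (ENNReal.ofReal q) volume ≤
      ENNReal.ofReal (2 * R ^ (-gain q) * ‖f‖) := by
  have hq0 : 0 < q := by linarith
  refine (eLpNorm_le_of_bound_of_eLpNorm_two hq (by positivity) (by positivity)
    (ae_norm_synth_band_le hω hR (by positivity) f)
    (eLpNorm_le_ofReal_of_norm_le (norm_synth_le hω _ hR (fun ξ h => h.1) f))).trans ?_
  apply ENNReal.ofReal_le_ofReal
  have e1 : 0 ≤ 1 - 2 / q := by
    rw [sub_nonneg, div_le_one hq0]; exact hq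
  -- The `L^∞` bound scales as `R^{-1/2} R^{3/4} = R^{1/4}` and the `L²` bound as `R^{-1/2}`;
  -- interpolation gives the exponent `(1/4)(1 - 2/q) - 1/q = -gain q`.
  have h1 : (√R)⁻¹ * √(2 * R * √(2 * R)) ≤ 2 * R ^ (1 / 4 : ℝ) := by
    have h3 : √(2 * R * √(2 * R)) ≤ √R * (2 * R ^ (1 / 4 : ℝ)) := by
      apply Real.sqrt_le_iff.2
      refine ⟨by positivity, ?_⟩
      have h4 : (R ^ (1 / 4 : ℝ)) ^ 2 = √R := by
        rw [← Real.rpow_natCast, ← Real.rpow_mul hR.le, Real.sqrt_eq_rpow]; norm_num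
      rw [mul_pow, mul_pow, h4, Real.sq_sqrt hR.le]
      have h5 : √(2 * R) ≤ 2 * √R := by
        rw [Real.sqrt_le_iff]
        refine ⟨by positivity, ?_⟩
        rw [mul_pow, Real.sq_sqrt hR.le]; linarith
      nlinarith
    rw [inv_mul_le_iff₀ (by positivity)]
    exact h3
  calc ((√R)⁻¹ * √(2 * R * √(2 * R)) * ‖f‖) ^ (1 - 2 / q) * ((√R)⁻¹ * ‖f‖) ^ (2 / q)
      ≤ (2 * R ^ (1 / 4 : ℝ) * ‖f‖) ^ (1 - 2 / q) * ((√R)⁻¹ * ‖f‖) ^ (2 / q) := by gcongr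
    _ = (2 : ℝ) ^ (1 - 2 / q) * (R ^ ((1 / 4 : ℝ) * (1 - 2 / q)) * R ^ (-(1 / 2) * (2 / q))) *
        (‖f‖ ^ (1 - 2 / q) * ‖f‖ ^ (2 / q)) := by
      rw [Real.mul_rpow (by positivity) (by positivity), Real.mul_rpow (by positivity)
        (by positivity), Real.mul_rpow (by positivity) (by positivity), Real.sqrt_eq_rpow,
        ← Real.rpow_neg hR.le, ← Real.rpow_mul hR.le, ← Real.rpow_mul hR.le]
      ring
    _ = (2 : ℝ) ^ (1 - 2 / q) * R ^ (-gain q) * ‖f‖ := by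
      rw [← Real.rpow_add hR, ← Real.rpow_add' (norm_nonneg _) (by simp)]
      congr 2
      · unfold gain
        congr 1
        field_simp
        ring
      · simp
    _ ≤ 2 * R ^ (-gain q) * ‖f‖ := by
      gcongr
      conv_rhs => rw [← Real.rpow_one 2]
      gcongr
      · norm_num
      · have : 0 ≤ 2 / q := by positivity
        linarith

/-- The geometric ratio of the dyadic sum. -/
theorem ratio_lt_one {q : ℝ} (hq : 0 < q) (hq6 : q < 6) : (2 : ℝ) ^ (-gain q) < 1 :=
  Real.rpow_lt_one_of_one_lt_of_neg (by norm_num) (neg_neg_of_pos (gain_pos hq hq6))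

theorem eLpNorm_synth_band_le {ω : ℝ} (hω : 0 < ω) {q : ℝ} (hq : 2 ≤ q) {R : ℝ}
    (hR : 0 < R) (f : L2) (n : ℕ) :
    eLpNorm (synth hω (measurableSet_band ω R (2 ^ n * R)) f) (ENNReal.ofReal q) volume ≤
      ENNReal.ofReal (∑ k ∈ Finset.range n, 2 * R ^ (-gain q) * ‖f‖ * ((2 : ℝ) ^ (-gain q)) ^ k) := by
  induction n with
  | zero =>
    have h : band ω R (2 ^ 0 * R) = ∅ := by simp [band]
    have h0 : synth hω (measurableSet_band ω R (2 ^ 0 * R)) f = 0 := by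
      rw [synth_congr hω _ MeasurableSet.empty h, ← norm_le_zero_iff]
      apply le_of_forall_pos_le_add
      intro ε hε
      by_contra! hlt
      -- On the empty set every lower bound for the weight holds vacuously, so `norm_synth_le`
      -- applies with `R = r²` for arbitrarily large `r`.
      obtain ⟨r, hr⟩ : ∃ r : ℝ, 0 < r ∧ r⁻¹ * ‖f‖ < ε := by
        refine ⟨(‖f‖ + 1) / ε, by positivity, ?_⟩
        rw [inv_div, div_mul_eq_mul_div, div_lt_iff₀ (by positivity)]
        nlinarith
      have := norm_synth_le hω MeasurableSet.empty (R := r ^ 2) (by have := hr.1; positivity)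
        (by simp) f
      rw [Real.sqrt_sq hr.1.le] at this
      linarith
    rw [h0, eLpNorm_congr_ae (Lp.coeFn_zero _ _ _)]
    simp
  | succ n ih =>
    have hdisj : Disjoint (band ω R (2 ^ n * R)) (band ω (2 ^ n * R) (2 * (2 ^ n * R))) := by
      apply Disjoint.preimage
      rw [Set.disjoint_left]
      intro x h1 h2
      exact absurd h1.2 (not_lt.2 h2.1)
    have h2n : (1 : ℝ) ≤ 2 ^ n := one_le_pow₀ (by norm_num)
    have hun : band ω R (2 ^ (n + 1) * R) =
        band ω R (2 ^ n * R) ∪ band ω (2 ^ n * R) (2 * (2 ^ n * R)) := by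
      rw [band, band, band, ← Set.preimage_union, Set.Ico_union_Ico_eq_Ico (by nlinarith)
        (by nlinarith [mul_pos (show (0 : ℝ) < 2 ^ n by positivity) hR]), pow_succ]
      ring_nf
    rw [synth_congr hω _ ((measurableSet_band _ _ _).union (measurableSet_band _ _ _)) hun,
      synth_union hω (measurableSet_band _ _ _) (measurableSet_band _ _ _) hdisj, eLpNorm_congr_ae (Lp.coeFn_add _ _)]
    refine (eLpNorm_add_le (Lp.aestronglyMeasurable _) (Lp.aestronglyMeasurable _)
      (by rw [ENNReal.one_le_ofReal]; linarith)).trans ?_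
    rw [Finset.sum_range_succ, ENNReal.ofReal_add (by positivity) (by positivity)]
    refine add_le_add ih ((eLpNorm_synth_dyadic_le hω hq (by positivity) f).trans_eq ?_)
    congr 1
    rw [Real.mul_rpow (by positivity) hR.le, ← Real.rpow_natCast, ← Real.rpow_mul (by norm_num),
      ← Real.rpow_natCast, ← Real.rpow_mul (by norm_num), mul_comm (n : ℝ)]
    ring

/-- The constant of the embedding into `L^q`. -/
def embeddingConst (q : ℝ) : ℝ := 2 / (1 - (2 : ℝ) ^ (-gain q))

theorem embeddingConst_pos {q : ℝ} (hq : 0 < q) (hq6 : q < 6) : 0 < embeddingConst q :=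
  div_pos two_pos (sub_pos.2 (ratio_lt_one hq hq6))

/-- The frequency region `{R ≤ weight ω}`. -/
abbrev high (ω R : ℝ) : Set Plane := weight ω ⁻¹' Set.Ici R

theorem measurableSet_high (ω R : ℝ) : MeasurableSet (high ω R) :=
  measurableSet_weight ω measurableSet_Ici

theorem synth_high_eq {ω : ℝ} (hω : 0 < ω) {R ρ : ℝ} (h : R ≤ ρ) (f : L2) :
    synth hω (measurableSet_high ω R) f =
      synth hω (measurableSet_band ω R ρ) f + synth hω (measurableSet_high ω ρ) f := by
  have hdisj : Disjoint (band ω R ρ) (high ω ρ) := by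
    apply Disjoint.preimage
    rw [Set.disjoint_left]
    intro x h1 h2
    exact absurd h1.2 (not_lt.2 h2)
  rw [← synth_union hω _ _ hdisj]
  congr 1
  apply synth_congr
  rw [band, high, high, ← Set.preimage_union, Set.Ico_union_Ici_eq_Ici h]

/-- The embedding into `L^q`, with a gain on high frequencies. -/
theorem eLpNorm_synth_high_le {ω : ℝ} (hω : 0 < ω) {q : ℝ} (hq : 2 ≤ q) (hq6 : q < 6) {R : ℝ}
    (hR : 0 < R) (f : L2) :
    eLpNorm (synth hω (measurableSet_high ω R) f) (ENNReal.ofReal q) volume ≤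
      ENNReal.ofReal (embeddingConst q * R ^ (-gain q) * ‖f‖) := by
  have hlim : Tendsto (fun n : ℕ => synth hω (measurableSet_band ω R (2 ^ n * R)) f) atTop
      (𝓝 (synth hω (measurableSet_high ω R) f)) := by
    rw [tendsto_iff_norm_sub_tendsto_zero]
    have h0 : Tendsto (fun n : ℕ => (√(2 ^ n * R))⁻¹ * ‖f‖) atTop (𝓝 (0 * ‖f‖)) := by
      refine Tendsto.mul_const _ (tendsto_inv_atTop_zero.comp (Real.tendsto_sqrt_atTop.comp ?_))
      exact (tendsto_pow_atTop_atTop_of_one_lt (by norm_num)).atTop_mul_const hR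
    rw [zero_mul] at h0
    refine squeeze_zero (fun _ => norm_nonneg _) (fun n => ?_) h0
    have h2n : (1 : ℝ) ≤ 2 ^ n := one_le_pow₀ (by norm_num)
    rw [synth_high_eq hω (ρ := 2 ^ n * R) (by nlinarith), norm_sub_rev, add_sub_cancel_left]
    exact norm_synth_le hω _ (by positivity) (fun ξ h => h) f
  -- The bands exhaust the high frequencies only in `L²`; an almost everywhere convergent
  -- subsequence carries the uniform `L^q` bound to the limit, by Fatou.
  obtain ⟨ns, -, hns⟩ := (tendstoInMeasure_of_tendsto_Lp hlim).exists_seq_tendsto_ae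
  refine Lp.eLpNorm_le_of_ae_tendsto (.of_forall fun n => ?_)
    (fun n => Lp.aestronglyMeasurable _) hns
  refine (eLpNorm_synth_band_le hω hq hR f (ns n)).trans (ENNReal.ofReal_le_ofReal ?_)
  have hr := ratio_lt_one (by linarith) hq6
  have hr0 : 0 < (2 : ℝ) ^ (-gain q) := by positivity
  rw [← Finset.mul_sum]
  calc 2 * R ^ (-gain q) * ‖f‖ * ∑ k ∈ Finset.range (ns n), ((2 : ℝ) ^ (-gain q)) ^ k
      ≤ 2 * R ^ (-gain q) * ‖f‖ * (1 - (2 : ℝ) ^ (-gain q))⁻¹ := by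
        gcongr
        rw [← tsum_geometric_of_lt_one hr0.le hr]
        exact (summable_geometric_of_lt_one hr0.le hr).sum_le_tsum _ (fun _ _ => by positivity)
    _ = _ := by unfold embeddingConst; ring

/-! ### The potential energy -/

/-- The Fourier multiplier `weight ω ^ (-1/2)` composed with the inverse Fourier transform. It is
an isometry of `L²` onto the energy space. -/
def fullSynth {ω : ℝ} (hω : 0 < ω) : L2 →L[ℂ] L2 := synth hω (measurableSet_high ω ω)

theorem memLp_fullSynth {ω : ℝ} (hω : 0 < ω) {q : ℝ} (hq : 2 ≤ q) (hq6 : q < 6) (f : L2) :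
    MemLp (fullSynth hω f) (ENNReal.ofReal q) volume :=
  ⟨Lp.aestronglyMeasurable _,
    (eLpNorm_synth_high_le hω hq hq6 hω f).trans_lt ENNReal.ofReal_lt_top⟩

/-- The potential energy `∫ |u|^q` of `u = fullSynth hω f`. -/
def power {ω : ℝ} (hω : 0 < ω) (q : ℝ) (f : L2) : ℝ := ∫ z, ‖fullSynth hω f z‖ ^ q

theorem power_nonneg {ω : ℝ} (hω : 0 < ω) (q : ℝ) (f : L2) : 0 ≤ power hω q f :=
  integral_nonneg fun _ => by positivity

theorem eLpNorm_ofReal_eq {α E : Type*} [MeasurableSpace α] {μ : Measure α}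
    [NormedAddCommGroup E] {g : α → E} {q : ℝ} (hq : 0 < q)
    (hg : MemLp g (ENNReal.ofReal q) μ) :
    eLpNorm g (ENNReal.ofReal q) μ = ENNReal.ofReal ((∫ x, ‖g x‖ ^ q ∂μ) ^ q⁻¹) := by
  rw [hg.eLpNorm_eq_integral_rpow_norm (by simpa using hq) ENNReal.ofReal_ne_top,
    ENNReal.toReal_ofReal hq.le]

theorem integrable_norm_rpow_fullSynth {ω : ℝ} (hω : 0 < ω) {q : ℝ} (hq : 2 ≤ q) (hq6 : q < 6)
    (f : L2) : Integrable fun z => ‖fullSynth hω f z‖ ^ q := by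
  have h := (memLp_fullSynth hω hq hq6 f).integrable_norm_rpow
    (by simp; linarith) ENNReal.ofReal_ne_top
  rwa [ENNReal.toReal_ofReal (by linarith)] at h

theorem power_rpow_inv_le {ω : ℝ} (hω : 0 < ω) {q : ℝ} (hq : 2 ≤ q) (hq6 : q < 6) (f : L2) :
    power hω q f ^ q⁻¹ ≤ embeddingConst q * ω ^ (-gain q) * ‖f‖ := by
  have h := eLpNorm_synth_high_le hω hq hq6 hω f
  have hc := embeddingConst_pos (by linarith) hq6
  rwa [← fullSynth, eLpNorm_ofReal_eq (by linarith) (memLp_fullSynth hω hq hq6 f),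
    ENNReal.ofReal_le_ofReal_iff (by positivity)] at h

theorem power_smul {ω : ℝ} (hω : 0 < ω) (q : ℝ) (c : ℂ) (f : L2) :
    power hω q (c • f) = ‖c‖ ^ q * power hω q f := by
  unfold power
  rw [map_smul, ← integral_const_mul]
  refine integral_congr_ae ?_
  filter_upwards [Lp.coeFn_smul c (fullSynth hω f)] with z hz
  rw [hz, Pi.smul_apply, norm_smul, Real.mul_rpow (norm_nonneg _) (norm_nonneg _)]

theorem power_modulate {ω : ℝ} (hω : 0 < ω) (q : ℝ) (a : Plane) (f : L2) :
    power hω q (modulate a f) = power hω q f := by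
  unfold power
  rw [← integral_add_right_eq_self (fun z => ‖fullSynth hω f z‖ ^ q) a]
  refine integral_congr_ae ?_
  filter_upwards [synth_modulate hω (measurableSet_high ω ω) a f] with z hz
  rw [fullSynth, hz]

/-- Lets one fixed functional, evaluation at the origin, detect concentration at a moving point. -/
theorem inner_kernel_modulate {ω : ℝ} (hω : 0 < ω) {S : Set Plane} (hS : MeasurableSet S)
    (hfin : volume S ≠ ∞) (z : Plane) (f : L2) :
    inner ℂ (kernel hω hS hfin 0) (modulate z f) = inner ℂ (kernel hω hS hfin z) f := by
  simp only [inner_kernel]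
  refine integral_congr_ae ?_
  filter_upwards [mulOp_coeFn (memLp_character z) f] with ξ h
  rw [modulate, h]
  simp [character]
  ring

/-- A function of bounded energy whose `L^q` norm is bounded below has a low-frequency part that
is bounded below at some point. -/
theorem exists_lower_bound_kernel {ω : ℝ} (hω : 0 < ω) {q : ℝ} (hq : 2 < q) (hq6 : q < 6) {a : ℝ}
    (ha : 0 < a) : ∃ ρ : ℝ, ∃ hρ : 0 ≤ ρ, ∃ c > 0, ∀ f : L2, ‖f‖ ≤ 1 → a ≤ power hω q f →
      ∃ z, c ≤ ‖inner ℂ (kernel hω (measurableSet_band ω ω ρ) (volume_band_ne_top hω ω hρ) z) f‖ := by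
  have hq0 : 0 < q := by linarith
  set b := a ^ q⁻¹ with hb
  have hb0 : 0 < b := by positivity
  have hK := embeddingConst_pos hq0 hq6
  have hlim1 : Tendsto (fun ρ : ℝ => embeddingConst q * ρ ^ (-gain q)) atTop (𝓝 0) := by
    simpa using (tendsto_rpow_neg_atTop (gain_pos hq0 hq6)).const_mul (embeddingConst q)
  -- The cutoff `ρ` leaves the high frequencies less than half of the `L^q` norm `b`; `c` is then so
  -- small that a low-frequency part bounded by `c` would supply less than the other half.
  obtain ⟨ρ, hρb, hρω⟩ := ((hlim1.eventually_lt_const (half_pos hb0)).and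
    (eventually_ge_atTop ω)).exists
  have hρ : 0 < ρ := by linarith
  have he : 0 < 1 - 2 / q := by
    rw [sub_pos, div_lt_one hq0]; exact hq
  have hlim2 : Tendsto (fun c : ℝ => c ^ (1 - 2 / q) * (√ω)⁻¹ ^ (2 / q)) (𝓝[>] 0) (𝓝 0) := by
    have h := (Real.continuousAt_rpow_const 0 (1 - 2 / q) (Or.inr he.le)).tendsto.mul_const
      ((√ω)⁻¹ ^ (2 / q))
    rw [Real.zero_rpow he.ne', zero_mul] at h
    exact h.mono_left nhdsWithin_le_nhds
  obtain ⟨c, hcb, hc⟩ := ((hlim2.eventually_lt_const (half_pos hb0)).and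
    self_mem_nhdsWithin).exists
  have hc0 : 0 < c := hc
  refine ⟨ρ, hρ.le, c, hc0, fun f hf haf => ?_⟩
  by_contra! hlt
  have hlow : eLpNorm (synth hω (measurableSet_band ω ω ρ) f) (ENNReal.ofReal q) volume ≤
      ENNReal.ofReal (c ^ (1 - 2 / q) * (√ω)⁻¹ ^ (2 / q)) := by
    refine eLpNorm_le_of_bound_of_eLpNorm_two hq.le (by positivity) hc0.le ?_
      (eLpNorm_le_ofReal_of_norm_le ?_)
    · filter_upwards [synth_eq_inner_kernel hω (measurableSet_band ω ω ρ)
        (volume_band_ne_top hω ω hρ.le) f] with z hz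
      rw [hz]
      exact (hlt z).le
    · refine (norm_synth_le hω _ hω (fun ξ h => h.1) f).trans ?_
      exact mul_le_of_le_one_right (by positivity) hf
  have hhigh := eLpNorm_synth_high_le hω hq.le hq6 hρ f
  have hsum : eLpNorm (fullSynth hω f) (ENNReal.ofReal q) volume ≤
      ENNReal.ofReal (c ^ (1 - 2 / q) * (√ω)⁻¹ ^ (2 / q)) +
        ENNReal.ofReal (embeddingConst q * ρ ^ (-gain q) * ‖f‖) := by
    rw [fullSynth, synth_high_eq hω hρω, eLpNorm_congr_ae (Lp.coeFn_add _ _)]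
    exact (eLpNorm_add_le (Lp.aestronglyMeasurable _) (Lp.aestronglyMeasurable _)
      (by rw [ENNReal.one_le_ofReal]; linarith)).trans (add_le_add hlow hhigh)
  rw [← ENNReal.ofReal_add (by positivity) (by positivity),
    eLpNorm_ofReal_eq hq0 (memLp_fullSynth hω hq.le hq6 f),
    ENNReal.ofReal_le_ofReal_iff (by positivity)] at hsum
  have h1 : b ≤ power hω q f ^ q⁻¹ := by
    rw [hb]; gcongr
  have h2 : embeddingConst q * ρ ^ (-gain q) * ‖f‖ ≤ embeddingConst q * ρ ^ (-gain q) :=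
    mul_le_of_le_one_right (by positivity) hf
  unfold power at h1
  linarith

/-! ### Compactness -/

/-- Convexity of `x ↦ x^q` applied to `(1 - t)(‖a‖/(1 - t)) + t(‖b‖/t)`, with `t` so small that `(1
- t)^(1-q) < 1 + ε`. -/
theorem exists_rpow_norm_add_le {q : ℝ} (hq : 1 ≤ q) {ε : ℝ} (hε : 0 < ε) :
    ∃ C : ℝ, 0 ≤ C ∧ ∀ a b : ℂ, ‖a + b‖ ^ q ≤ (1 + ε) * ‖a‖ ^ q + C * ‖b‖ ^ q := by
  have hlim : Tendsto (fun t : ℝ => (1 - t) ^ (1 - q)) (𝓝[>] 0) (𝓝 1) := by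
    have h : ContinuousAt (fun t : ℝ => (1 - t) ^ (1 - q)) 0 :=
      (continuousAt_const.sub continuousAt_id).rpow_const (Or.inl (by simp))
    have h' := h.tendsto
    simp only [sub_zero, Real.one_rpow] at h'
    exact h'.mono_left nhdsWithin_le_nhds
  have h1 : ∀ᶠ t : ℝ in 𝓝[>] 0, t < 1 :=
    eventually_nhdsWithin_of_eventually_nhds (eventually_lt_nhds one_pos)
  obtain ⟨t, ⟨ht, ht1⟩, ht0⟩ := (((hlim.eventually_lt_const
    (show (1 : ℝ) < 1 + ε by linarith)).and h1).and self_mem_nhdsWithin).exists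
  have ht0 : 0 < t := ht0
  refine ⟨t ^ (1 - q), by positivity, fun a b => ?_⟩
  have hs : 0 < 1 - t := by linarith
  have hconv := (convexOn_rpow hq).2 (x := ‖a‖ / (1 - t)) (y := ‖b‖ / t)
    (Set.mem_Ici.2 (by positivity)) (Set.mem_Ici.2 (by positivity)) hs.le ht0.le (by ring)
  simp only [smul_eq_mul] at hconv
  have hid : ∀ s : ℝ, 0 < s → ∀ x : ℝ, 0 ≤ x → s * (x / s) ^ q = s ^ (1 - q) * x ^ q := by
    intro s hs x hx
    rw [Real.div_rpow hx hs.le, Real.rpow_sub hs, Real.rpow_one]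
    ring
  rw [hid _ hs _ (norm_nonneg _), hid _ ht0 _ (norm_nonneg _), mul_div_cancel₀ _ hs.ne',
    mul_div_cancel₀ _ ht0.ne'] at hconv
  calc ‖a + b‖ ^ q ≤ (‖a‖ + ‖b‖) ^ q := by gcongr; exact norm_add_le _ _
    _ ≤ _ := hconv
    _ ≤ _ := by gcongr

/-- One half of the Brezis–Lieb lemma. -/
theorem eventually_integral_rpow_norm_le {α : Type*} [MeasurableSpace α] {μ : Measure α} {q : ℝ}
    (hq : 1 ≤ q) {f : ℕ → α → ℂ} {g : α → ℂ} (hf : ∀ n, MemLp (f n) (ENNReal.ofReal q) μ)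
    (hg : MemLp g (ENNReal.ofReal q) μ)
    (hlim : ∀ᵐ x ∂μ, Tendsto (fun n => f n x) atTop (𝓝 (g x))) {ε : ℝ} (hε : 0 < ε) :
    ∀ᶠ n in atTop, ∫ x, ‖f n x‖ ^ q ∂μ ≤
      (1 + ε) * ∫ x, ‖f n x - g x‖ ^ q ∂μ + ∫ x, ‖g x‖ ^ q ∂μ + ε := by
  have hq0 : 0 < q := by linarith
  have hint : ∀ {h : α → ℂ}, MemLp h (ENNReal.ofReal q) μ → Integrable (fun x => ‖h x‖ ^ q) μ := by
    intro h hh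
    have := hh.integrable_norm_rpow (by simpa using hq0) ENNReal.ofReal_ne_top
    rwa [ENNReal.toReal_ofReal hq0.le] at this
  have hsub : ∀ n, Integrable (fun x => ‖f n x - g x‖ ^ q) μ := fun n => hint ((hf n).sub hg)
  obtain ⟨C, hC, hineq⟩ := exists_rpow_norm_add_le hq hε
  -- The positive part of the defect is dominated by `C ‖g‖^q` uniformly in `n` and tends to `0`
  -- almost everywhere, so its integral vanishes in the limit.
  let W : ℕ → α → ℝ := fun n x =>
    max (‖f n x‖ ^ q - (1 + ε) * ‖f n x - g x‖ ^ q - ‖g x‖ ^ q) 0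
  have hWint : ∀ n, Integrable (W n) μ := fun n =>
    (((hint (hf n)).sub ((hsub n).const_mul _)).sub (hint hg)).pos_part
  have hW : Tendsto (fun n => ∫ x, W n x ∂μ) atTop (𝓝 (∫ _, 0 ∂μ)) := by
    refine tendsto_integral_of_dominated_convergence (fun x => C * ‖g x‖ ^ q)
      (fun n => (hWint n).aestronglyMeasurable) ((hint hg).const_mul _) (fun n => ?_) ?_
    · refine .of_forall fun x => ?_
      rw [Real.norm_of_nonneg (le_max_right _ _)]
      refine max_le ?_ (by positivity)
      have := hineq (f n x - g x) (g x)
      rw [sub_add_cancel] at this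
      have : 0 ≤ ‖g x‖ ^ q := by positivity
      linarith
    · filter_upwards [hlim] with x hx
      have h1 : Tendsto (fun n => ‖f n x‖ ^ q) atTop (𝓝 (‖g x‖ ^ q)) :=
        hx.norm.rpow_const (Or.inr hq0.le)
      have h2 : Tendsto (fun n => ‖f n x - g x‖ ^ q) atTop (𝓝 (‖g x - g x‖ ^ q)) :=
        (hx.sub_const _).norm.rpow_const (Or.inr hq0.le)
      rw [sub_self, norm_zero, Real.zero_rpow hq0.ne'] at h2
      have h3 := ((h1.sub (h2.const_mul (1 + ε))).sub_const (‖g x‖ ^ q)).max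
        (tendsto_const_nhds (x := (0 : ℝ)))
      simpa [W] using h3
  rw [integral_zero] at hW
  filter_upwards [hW.eventually_lt_const hε] with n hn
  have h1 : ∫ x, ‖f n x‖ ^ q ∂μ ≤
      ∫ x, ((1 + ε) * ‖f n x - g x‖ ^ q + ‖g x‖ ^ q + W n x) ∂μ := by
    refine integral_mono (hint (hf n)) ((((hsub n).const_mul _).add (hint hg)).add (hWint n)) ?_
    intro x
    have : ‖f n x‖ ^ q - (1 + ε) * ‖f n x - g x‖ ^ q - ‖g x‖ ^ q ≤ W n x := le_max_left _ _
    simp only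
    linarith
  have h2 : Integrable (fun x => (1 + ε) * ‖f n x - g x‖ ^ q + ‖g x‖ ^ q) μ :=
    ((hsub n).const_mul _).add (hint hg)
  rw [integral_add h2 (hWint n),
    integral_add ((hsub n).const_mul _) (hint hg), integral_const_mul] at h1
  linarith

/-- A finite measure equivalent to a `σ`-finite one and bounded by it. -/
theorem exists_small_equivalent_measure {α : Type*} [MeasurableSpace α] (μ : Measure α)
    [SigmaFinite μ] : ∃ ν : Measure α, ν Set.univ ≤ 1 ∧ ν ≤ μ ∧ μ ≪ ν := by
  obtain ⟨w, hw0, hwm, hw⟩ := exists_pos_lintegral_lt_of_sigmaFinite μ one_ne_zero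
  have hm : Measurable fun x => min 1 (w x : ℝ≥0∞) :=
    measurable_const.min hwm.coe_nnreal_ennreal
  refine ⟨μ.withDensity fun x => min 1 (w x : ℝ≥0∞), ?_, ?_, ?_⟩
  · rw [withDensity_apply _ MeasurableSet.univ, Measure.restrict_univ]
    exact (lintegral_mono fun x => min_le_right _ _).trans hw.le
  · conv_rhs => rw [← withDensity_one (μ := μ)]
    exact withDensity_mono (.of_forall fun x => min_le_left _ _)
  · refine withDensity_absolutelyContinuous' hm.aemeasurable (.of_forall fun x => ?_)
    have := hw0 x
    simp [min_eq_iff, this.ne']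

/-- Weak convergence in the energy space implies almost everywhere convergence of a
subsequence. -/
theorem exists_subseq_ae_tendsto_fullSynth {ω : ℝ} (hω : 0 < ω) {f : ℕ → L2} {g : L2} {B : ℝ}
    (hB : ∀ n, ‖f n‖ ≤ B)
    (hfg : ∀ k : L2, Tendsto (fun n => inner ℂ k (f n)) atTop (𝓝 (inner ℂ k g))) :
    ∃ ns : ℕ → ℕ, StrictMono ns ∧ ∀ᵐ z : Plane,
      Tendsto (fun i => fullSynth hω (f (ns i)) z) atTop (𝓝 (fullSynth hω g z)) := by
  obtain ⟨ν, hν1, hνle, hνac⟩ := exists_small_equivalent_measure (volume : Measure Plane)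
  have : IsFiniteMeasure ν := ⟨hν1.trans_lt ENNReal.one_lt_top⟩
  have hνac' : ν ≪ volume := Measure.absolutelyContinuous_of_le hνle
  set A := B + ‖g‖ with hA
  have hA0 : 0 ≤ A := add_nonneg ((norm_nonneg _).trans (hB 0)) (norm_nonneg _)
  have hd : ∀ n, ‖f n - g‖ ≤ A := fun n => (norm_sub_le _ _).trans (by rw [hA]; gcongr; exact hB n)
  -- Convergence in `L¹(ν)`: the high frequencies are small uniformly in `n`, while the
  -- low-frequency part tends to `0` at each point by weak convergence against the kernel and is
  -- bounded, hence dominated as `ν` is finite.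
  have hmain : Tendsto (fun n => eLpNorm (fullSynth hω (f n - g)) 1 ν) atTop (𝓝 0) := by
    rw [ENNReal.tendsto_nhds_zero]
    intro ε hε
    have hlim : Tendsto (fun ρ : ℝ => ENNReal.ofReal ((√ρ)⁻¹ * A)) atTop (𝓝 0) := by
      have h := ((tendsto_inv_atTop_zero.comp Real.tendsto_sqrt_atTop).mul_const A)
      rw [zero_mul] at h
      simpa using ENNReal.tendsto_ofReal h
    obtain ⟨ρ, hρε, hρω⟩ := ((hlim.eventually_le_const (ENNReal.half_pos hε.ne')).and
      (eventually_ge_atTop ω)).exists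
    have hρ : 0 < ρ := by linarith
    set K := fun z => kernel hω (measurableSet_band ω ω ρ) (volume_band_ne_top hω ω hρ.le) z with hK
    have hlow : Tendsto (fun n => eLpNorm (fun z => inner ℂ (K z) (f n - g)) 1 ν) atTop (𝓝 0) := by
      simp only [eLpNorm_one_eq_lintegral_enorm]
      rw [← lintegral_zero (μ := ν)]
      refine tendsto_lintegral_of_dominated_convergence
        (fun _ => ENNReal.ofReal ((√ω)⁻¹ * √(ρ * √ρ) * A)) (fun n => ?_) (fun n => ?_) ?_ ?_
      · exact (continuous_inner_kernel hω _ _ (f n - g)).measurable.enorm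
      · refine .of_forall fun z => ?_
        change ‖inner ℂ (K z) (f n - g)‖ₑ ≤ ENNReal.ofReal _
        rw [← ofReal_norm]
        apply ENNReal.ofReal_le_ofReal
        refine (norm_inner_le_norm _ _).trans ?_
        gcongr
        · exact norm_kernel_band_le hω hω hρ.le z
        · exact hd n
      · rw [lintegral_const]
        exact ENNReal.mul_ne_top ENNReal.ofReal_ne_top (measure_ne_top _ _)
      · refine .of_forall fun z => ?_
        have h := ((hfg (K z)).sub_const (inner ℂ (K z) g))
        simp only [← inner_sub_right, sub_self] at h
        simpa using h.enorm
    filter_upwards [(ENNReal.tendsto_nhds_zero.1 hlow) _ (ENNReal.half_pos hε.ne')] with n hn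
    have hsplit : (fullSynth hω (f n - g) : Plane → ℂ) =ᵐ[ν]
        (fun z => inner ℂ (K z) (f n - g)) + synth hω (measurableSet_high ω ρ) (f n - g) := by
      refine hνac'.ae_le ?_
      filter_upwards [synth_eq_inner_kernel hω (measurableSet_band ω ω ρ)
        (volume_band_ne_top hω ω hρ.le) (f n - g),
        Lp.coeFn_add (synth hω (measurableSet_band ω ω ρ) (f n - g))
          (synth hω (measurableSet_high ω ρ) (f n - g))] with z h1 h2
      rw [fullSynth, synth_high_eq hω hρω, h2, Pi.add_apply, Pi.add_apply, h1]
    rw [eLpNorm_congr_ae hsplit, ← ENNReal.add_halves ε]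
    have hmeas : AEStronglyMeasurable (synth hω (measurableSet_high ω ρ) (f n - g)) ν :=
      (Lp.aestronglyMeasurable _).mono_ac hνac'
    refine (eLpNorm_add_le (continuous_inner_kernel hω _ _ (f n - g)).aestronglyMeasurable
      hmeas le_rfl).trans (add_le_add hn ?_)
    calc eLpNorm (synth hω (measurableSet_high ω ρ) (f n - g)) 1 ν
        ≤ eLpNorm (synth hω (measurableSet_high ω ρ) (f n - g)) 2 ν *
          ν Set.univ ^ (1 / (1 : ℝ≥0∞).toReal - 1 / (2 : ℝ≥0∞).toReal) :=
          eLpNorm_le_eLpNorm_mul_rpow_measure_univ (by norm_num) hmeas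
      _ ≤ eLpNorm (synth hω (measurableSet_high ω ρ) (f n - g)) 2 ν * 1 := by
          gcongr
          exact ENNReal.rpow_le_one hν1 (by norm_num)
      _ ≤ eLpNorm (synth hω (measurableSet_high ω ρ) (f n - g)) 2 volume := by
          rw [mul_one]
          exact eLpNorm_mono_measure _ hνle
      _ ≤ ENNReal.ofReal ((√ρ)⁻¹ * A) := by
          apply eLpNorm_le_ofReal_of_norm_le
          refine (norm_synth_le hω _ hρ (fun ξ h => h) _).trans ?_
          gcongr
          exact hd n
      _ ≤ ε / 2 := hρε
  have hcongr : ∀ n, (fullSynth hω (f n - g) : Plane → ℂ) =ᵐ[ν]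
      (fullSynth hω (f n) : Plane → ℂ) - fullSynth hω g := fun n => by
    refine hνac'.ae_le ?_
    rw [map_sub]
    exact Lp.coeFn_sub _ _
  simp only [fun n => eLpNorm_congr_ae (p := 1) (hcongr n)] at hmain
  obtain ⟨ns, hns, hae⟩ := (tendstoInMeasure_of_tendsto_eLpNorm one_ne_zero
    (fun n => (Lp.aestronglyMeasurable _).mono_ac hνac')
    ((Lp.aestronglyMeasurable _).mono_ac hνac') hmain).exists_seq_tendsto_ae
  exact ⟨ns, hns, hνac.ae_le hae⟩

/-! ### The sharp constant is attained -/

/-- Bounded sequences in a separable Hilbert space have weakly convergent subsequences. -/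
theorem exists_subseq_tendsto_inner {H : Type*} [NormedAddCommGroup H] [InnerProductSpace ℂ H]
    [CompleteSpace H] [TopologicalSpace.SeparableSpace H] {f : ℕ → H} {B : ℝ}
    (hB : ∀ n, ‖f n‖ ≤ B) : ∃ g : H, ∃ ns : ℕ → ℕ, StrictMono ns ∧
      ∀ k : H, Tendsto (fun i => inner ℂ k (f (ns i))) atTop (𝓝 (inner ℂ k g)) := by
  let F : ℕ → WeakDual ℂ H := fun n => StrongDual.toWeakDual (InnerProductSpace.toDual ℂ H (f n))
  have hF : ∀ n, F n ∈ WeakDual.toStrongDual ⁻¹' Metric.closedBall (0 : StrongDual ℂ H) B := by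
    intro n
    simpa [F] using hB n
  obtain ⟨G, -, ns, hns, hlim⟩ := WeakDual.isSeqCompact_closedBall (𝕜 := ℂ) (E := H) 0 B hF
  refine ⟨(InnerProductSpace.toDual ℂ H).symm (WeakDual.toStrongDual G), ns, hns, fun k => ?_⟩
  have h1 : Tendsto (fun i => F (ns i) k) atTop (𝓝 (G k)) :=
    ((WeakDual.eval_continuous k).tendsto G).comp hlim
  have h2 := (Complex.continuous_conj.tendsto _).comp h1
  have e1 : ∀ i, conj (F (ns i) k) = inner ℂ k (f (ns i)) := fun i => inner_conj_symm _ _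
  have e2 : conj (G k) =
      inner ℂ k ((InnerProductSpace.toDual ℂ H).symm (WeakDual.toStrongDual G)) := by
    rw [← inner_conj_symm, InnerProductSpace.toDual_symm_apply]
    rfl
  rw [← e2]
  exact h2.congr e1

theorem power_zero {ω : ℝ} (hω : 0 < ω) {q : ℝ} (hq : 0 < q) : power hω q 0 = 0 := by
  have h := power_smul hω q 0 0
  rwa [zero_smul, norm_zero, Real.zero_rpow hq.ne', zero_mul] at h

theorem fullSynth_injective {ω : ℝ} (hω : 0 < ω) {f : L2} (h : fullSynth hω f = 0) : f = 0 := by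
  have h1 : mulOp (memLp_localSymbol hω (measurableSet_high ω ω)) f = 0 := by
    rw [← norm_eq_zero, ← norm_fourierInv, ← synth_apply hω (measurableSet_high ω ω), ← fullSynth, h,
      norm_zero]
  apply Lp.ext
  have h2 := mulOp_coeFn (memLp_localSymbol hω (measurableSet_high ω ω)) f
  rw [h1] at h2
  filter_upwards [h2, Lp.coeFn_zero ℂ 2 (volume : Measure Plane)] with ξ h3 h4
  rw [h4] at h3 ⊢
  have hw : 0 < weight ω ξ := hω.trans_le (le_weight ω ξ)
  have : localSymbol ω (high ω ω) ξ ≠ 0 := by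
    rw [localSymbol, Set.indicator_of_mem (show ξ ∈ high ω ω from le_weight ω ξ)]
    simpa using (Real.sqrt_pos.2 hw).ne'
  simpa [this] using h3

theorem power_pos {ω : ℝ} (hω : 0 < ω) {q : ℝ} (hq : 2 ≤ q) (hq6 : q < 6) {f : L2} (hf : f ≠ 0) :
    0 < power hω q f := by
  refine (power_nonneg hω q f).lt_of_ne' fun h => hf (fullSynth_injective hω ?_)
  have h1 := (integral_eq_zero_iff_of_nonneg (fun z => by positivity)
    (integrable_norm_rpow_fullSynth hω hq hq6 f)).1 h
  apply Lp.ext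
  filter_upwards [h1, Lp.coeFn_zero ℂ 2 (volume : Measure Plane)] with z hz h0
  rw [h0]
  have hz : ‖fullSynth hω f z‖ ^ q = 0 := hz
  rw [Real.rpow_eq_zero (norm_nonneg _) (by linarith)] at hz
  simpa using hz

/-- The sharp constant of the embedding into `L^q` is attained. -/
theorem exists_extremizer {ω : ℝ} (hω : 0 < ω) {q : ℝ} (hq : 2 < q) (hq6 : q < 6) :
    ∃ M > 0, ∃ g : L2, g ≠ 0 ∧ power hω q g = M * ‖g‖ ^ q ∧ ∀ f, power hω q f ≤ M * ‖f‖ ^ q := by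
  have hq0 : 0 < q := by linarith
  set V := power hω q with hV
  have hbdd : BddAbove (V '' Metric.closedBall 0 1) := by
    refine ⟨(embeddingConst q * ω ^ (-gain q)) ^ q, ?_⟩
    rintro _ ⟨f, hf, rfl⟩
    rw [mem_closedBall_zero_iff] at hf
    have hc := embeddingConst_pos hq0 hq6
    have h1 : V f ^ q⁻¹ ≤ embeddingConst q * ω ^ (-gain q) :=
      (power_rpow_inv_le hω hq.le hq6 f).trans (mul_le_of_le_one_right (by positivity) hf)
    have h0 : 0 ≤ V f := power_nonneg hω q f
    calc V f = (V f ^ q⁻¹) ^ q := by rw [Real.rpow_inv_rpow h0 hq0.ne']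
      _ ≤ _ := by gcongr
  have hne : (V '' Metric.closedBall 0 1).Nonempty := ⟨V 0, 0, by simp, rfl⟩
  set M := sSup (V '' Metric.closedBall 0 1) with hM
  have hunit : ∀ f : L2, ‖f‖ ≤ 1 → V f ≤ M := fun f hf =>
    le_csSup hbdd ⟨f, mem_closedBall_zero_iff.2 hf, rfl⟩
  have hall : ∀ f, V f ≤ M * ‖f‖ ^ q := by
    intro f
    by_cases hf : f = 0
    · rw [hf, hV, power_zero hω hq0, norm_zero, Real.zero_rpow hq0.ne', mul_zero]
    · have hn : 0 < ‖f‖ := norm_pos_iff.2 hf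
      have h1 := hunit (((‖f‖⁻¹ : ℝ) : ℂ) • f) (by
        rw [norm_smul, Complex.norm_real, Real.norm_of_nonneg (by positivity),
          inv_mul_cancel₀ hn.ne'])
      rw [hV, power_smul, Complex.norm_real, Real.norm_of_nonneg (by positivity),
        Real.inv_rpow hn.le, inv_mul_le_iff₀ (by positivity)] at h1
      linarith
  have hMpos : 0 < M := by
    obtain ⟨f, hf⟩ : ∃ f : L2, f ≠ 0 := by
      refine ⟨indicatorConstLp 2 (Metric.isOpen_ball (x := (0 : Plane)) (ε := 1)).measurableSet
        Metric.isBounded_ball.measure_lt_top.ne (1 : ℂ), fun h => ?_⟩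
      rw [← norm_eq_zero, norm_indicatorConstLp two_ne_zero ENNReal.ofNat_ne_top, norm_one, one_mul,
        Real.rpow_eq_zero measureReal_nonneg (by simp), measureReal_def,
        ENNReal.toReal_eq_zero_iff] at h
      rcases h with h | h
      · exact (Metric.measure_ball_pos volume (0 : Plane) one_pos).ne' h
      · exact Metric.isBounded_ball.measure_lt_top.ne h
    have h1 := power_pos hω hq.le hq6 hf
    have h2 := hall f
    by_contra! h
    have : M * ‖f‖ ^ q ≤ 0 := mul_nonpos_of_nonpos_of_nonneg h (by positivity)
    linarith
  obtain ⟨v, -, hvlim, hvmem⟩ := exists_seq_tendsto_sSup hne hbdd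
  choose u hu huv using hvmem
  simp only [mem_closedBall_zero_iff] at hu
  obtain ⟨ρ, hρ, c, hc, hker⟩ := exists_lower_bound_kernel hω hq hq6 (half_pos hMpos)
  have hker' : ∀ n, ∃ z, M / 2 ≤ V (u n) →
      c ≤ ‖inner ℂ (kernel hω (measurableSet_band ω ω ρ) (volume_band_ne_top hω ω hρ) z) (u n)‖ := by
    intro n
    by_cases h : M / 2 ≤ V (u n)
    · obtain ⟨z, hz⟩ := hker (u n) (hu n) h
      exact ⟨z, fun _ => hz⟩
    · exact ⟨0, fun h' => absurd h' h⟩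
  choose z hz using hker'
  set K := kernel hω (measurableSet_band ω ω ρ) (volume_band_ne_top hω ω hρ) 0 with hK
  -- Modulation preserves the norm and `power`, and moves the point of concentration to the origin.
  let w : ℕ → L2 := fun n => modulate (z n) (u n)
  have hw : ∀ n, ‖w n‖ ≤ 1 := fun n => (norm_modulate _ _).trans_le (hu n)
  have hwV : ∀ n, V (w n) = v n := fun n => (power_modulate hω q _ _).trans (huv n)
  have hwK : ∀ᶠ n in atTop, c ≤ ‖inner ℂ K (w n)‖ := by
    filter_upwards [hvlim.eventually_const_le (half_lt_self hMpos)] with n hn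
    rw [hK, inner_kernel_modulate]
    exact hz n (by rwa [huv])
  have : Fact ((2 : ℝ≥0∞) ≠ ∞) := ⟨ENNReal.ofNat_ne_top⟩
  obtain ⟨g, ns, hns, hweak⟩ := exists_subseq_tendsto_inner hw
  obtain ⟨ms, hms, hae⟩ := exists_subseq_ae_tendsto_fullSynth hω (fun i => hw (ns i)) hweak
  let f : ℕ → L2 := fun i => w (ns (ms i))
  have htop : Tendsto (fun i => ns (ms i)) atTop atTop := hns.tendsto_atTop.comp hms.tendsto_atTop
  have hfweak : ∀ k : L2, Tendsto (fun i => inner ℂ k (f i)) atTop (𝓝 (inner ℂ k g)) :=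
    fun k => (hweak k).comp hms.tendsto_atTop
  have hfV : Tendsto (fun i => V (f i)) atTop (𝓝 M) := by
    simp only [f, hwV]
    exact hvlim.comp htop
  have hg : g ≠ 0 := by
    rintro rfl
    have h1 := ge_of_tendsto (hfweak K).norm (htop.eventually hwK)
    rw [inner_zero_right, norm_zero] at h1
    linarith
  -- Only `‖f i‖ ≤ 1` is used; convergence of the norms is not needed.
  have hsq : ∀ i, ‖f i - g‖ ^ 2 ≤ 1 - 2 * (inner ℂ g (f i)).re + ‖g‖ ^ 2 := by
    intro i
    have h1 := norm_sub_sq (𝕜 := ℂ) (f i) g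
    have h2 : RCLike.re (inner ℂ (f i) g) = (inner ℂ g (f i)).re := inner_re_symm _ _
    have h3 : ‖f i‖ ≤ 1 := hw _
    rw [h1, h2]
    nlinarith [norm_nonneg (f i)]
  have hre : Tendsto (fun i => 1 - 2 * (inner ℂ g (f i)).re + ‖g‖ ^ 2) atTop
      (𝓝 (1 - ‖g‖ ^ 2)) := by
    have h1 := ((((Complex.continuous_re.tendsto _).comp (hfweak g)).const_mul 2).const_sub
      1).add_const (‖g‖ ^ 2)
    have h2 : (inner ℂ g g).re = ‖g‖ ^ 2 := by
      rw [inner_self_eq_norm_sq_to_K]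
      norm_cast
    rw [h2] at h1
    rw [show 1 - ‖g‖ ^ 2 = 1 - 2 * ‖g‖ ^ 2 + ‖g‖ ^ 2 by ring]
    exact h1
  have hg1 : 0 ≤ 1 - ‖g‖ ^ 2 :=
    ge_of_tendsto hre (.of_forall fun i => (sq_nonneg _).trans (hsq i))
  have hlim : Tendsto (fun i => M * (1 - 2 * (inner ℂ g (f i)).re + ‖g‖ ^ 2) ^ (q / 2)) atTop
      (𝓝 (M * (1 - ‖g‖ ^ 2) ^ (q / 2))) :=
    (hre.rpow_const (Or.inr (by positivity))).const_mul M
  have hsubV : ∀ i, V (f i - g) ≤ M * (1 - 2 * (inner ℂ g (f i)).re + ‖g‖ ^ 2) ^ (q / 2) := by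
    intro i
    refine (hall _).trans ?_
    have h1 : ‖f i - g‖ ^ q = (‖f i - g‖ ^ 2) ^ (q / 2) := by
      rw [← Real.rpow_natCast, ← Real.rpow_mul (norm_nonneg _)]
      congr 1
      push_cast; ring
    rw [h1]
    gcongr
    exact hsq i
  -- Brezis–Lieb along the subsequence, with the remainder controlled by `V (f i - g) ≤ M ‖f i -
  -- g‖^q`.
  have hε : ∀ ε > 0, M ≤ (1 + ε) * (M * (1 - ‖g‖ ^ 2) ^ (q / 2)) + V g + ε := by
    intro ε hε
    have h1 := eventually_integral_rpow_norm_le (q := q) (by linarith)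
      (fun i => memLp_fullSynth hω hq.le hq6 (f i)) (memLp_fullSynth hω hq.le hq6 g) hae hε
    refine le_of_tendsto_of_tendsto hfV (((hlim.const_mul (1 + ε)).add_const (V g)).add_const ε) ?_
    filter_upwards [h1] with i hi
    have h2 : ∫ x, ‖fullSynth hω (f i) x - fullSynth hω g x‖ ^ q = V (f i - g) := by
      rw [hV, power, map_sub]
      refine integral_congr_ae ?_
      filter_upwards [Lp.coeFn_sub (fullSynth hω (f i)) (fullSynth hω g)] with x hx
      rw [hx, Pi.sub_apply]
    rw [h2] at hi
    refine hi.trans ?_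
    have h3 := hsubV i
    have : (1 + ε) * V (f i - g) ≤
        (1 + ε) * (M * (1 - 2 * (inner ℂ g (f i)).re + ‖g‖ ^ 2) ^ (q / 2)) := by gcongr
    change _ + V g + ε ≤ _
    linarith
  have hmain : M ≤ M * (1 - ‖g‖ ^ 2) ^ (q / 2) + V g := by
    have h1 : Tendsto (fun ε : ℝ => (1 + ε) * (M * (1 - ‖g‖ ^ 2) ^ (q / 2)) + V g + ε) (𝓝[>] 0)
        (𝓝 ((1 + 0) * (M * (1 - ‖g‖ ^ 2) ^ (q / 2)) + V g + 0)) := by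
      refine Tendsto.mono_left ?_ nhdsWithin_le_nhds
      exact Continuous.tendsto (by fun_prop) 0
    have h2 := ge_of_tendsto h1 (eventually_nhdsWithin_of_forall hε)
    simpa using h2
  -- As `q/2 ≥ 1` and `‖g‖ ≤ 1`, `hmain` gives `V g ≥ M ‖g‖² ≥ M ‖g‖^q`.
  refine ⟨M, hMpos, g, hg, le_antisymm (hall g) ?_, hall⟩
  have hq1 : 1 ≤ q / 2 := by linarith
  have h1 : (1 - ‖g‖ ^ 2) ^ (q / 2) ≤ 1 - ‖g‖ ^ 2 := by
    conv_rhs => rw [← Real.rpow_one (1 - ‖g‖ ^ 2)]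
    exact Real.rpow_le_rpow_of_exponent_ge' hg1 (by linarith [sq_nonneg ‖g‖]) zero_le_one hq1
  have h2 : ‖g‖ ^ q ≤ ‖g‖ ^ 2 := by
    rw [← Real.rpow_natCast]
    refine Real.rpow_le_rpow_of_exponent_ge' (norm_nonneg _) ?_ (by norm_num) (by push_cast; linarith)
    nlinarith [norm_nonneg g]
  nlinarith [mul_le_mul_of_nonneg_left h1 hMpos.le, mul_le_mul_of_nonneg_left h2 hMpos.le]

/-! ### The energy space -/

theorem weight_pos {ω : ℝ} (hω : 0 < ω) (ξ : Plane) : 0 < weight ω ξ :=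
  hω.trans_le (le_weight ω ξ)

theorem normSq_symbolDx (ξ : Plane) : ‖symbolDx ξ‖ ^ 2 = (2 * Real.pi * ξ 0) ^ 2 := by
  simp only [symbolDx, norm_mul, Complex.norm_I, Complex.norm_real, Complex.norm_ofNat, mul_one,
    Real.norm_eq_abs, mul_pow, sq_abs]

theorem normSq_symbolHalfDy (ξ : Plane) : ‖symbolHalfDy ξ‖ ^ 2 = 2 * Real.pi * |ξ 1| := by
  have := Real.pi_pos
  rw [symbolHalfDy, Complex.norm_real, Real.norm_eq_abs, sq_abs, Real.sq_sqrt (by positivity)]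

theorem measurable_symbolDx : Measurable symbolDx := by
  have : Continuous symbolDx := by unfold symbolDx; fun_prop
  exact this.measurable

theorem measurable_symbolHalfDy : Measurable symbolHalfDy := by
  have : Continuous symbolHalfDy := by unfold symbolHalfDy; fun_prop
  exact this.measurable

theorem weight_eq (ω : ℝ) (ξ : Plane) :
    weight ω ξ = ‖symbolDx ξ‖ ^ 2 + ‖symbolHalfDy ξ‖ ^ 2 + ω := by
  rw [normSq_symbolDx, normSq_symbolHalfDy, weight]

theorem fourier_fullSynth {ω : ℝ} (hω : 0 < ω) (f : L2) :
    ((𝓕 (fullSynth hω f) : L2) : Plane → ℂ) =ᵐ[volume]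
      fun ξ => ((√(weight ω ξ))⁻¹ : ℝ) * f ξ := by
  have h : (𝓕 (fullSynth hω f) : L2) = mulOp (memLp_localSymbol hω (measurableSet_high ω ω)) f := by
    rw [fullSynth, synth_apply, FourierTransform.fourier_fourierInv_eq]
  rw [h]
  filter_upwards [mulOp_coeFn (memLp_localSymbol hω (measurableSet_high ω ω)) f] with ξ hξ
  rw [hξ, localSymbol, Set.indicator_of_mem (show ξ ∈ high ω ω from le_weight ω ξ)]

theorem fullSynth_mem_multiplierDomain {ω : ℝ} (hω : 0 < ω) (f : L2) {m : Plane → ℂ}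
    (hm : Measurable m) (hmw : ∀ ξ, ‖m ξ‖ ^ 2 ≤ weight ω ξ) :
    fullSynth hω f ∈ multiplierDomain m := by
  change MemLp (fun ξ => m ξ * (𝓕 (fullSynth hω f) : L2) ξ) 2 volume
  refine (Lp.memLp f).mono (hm.aestronglyMeasurable.mul (Lp.aestronglyMeasurable _)) ?_
  filter_upwards [fourier_fullSynth hω f] with ξ h
  rw [h, norm_mul, norm_mul, Complex.norm_real, Real.norm_of_nonneg (by positivity), ← mul_assoc]
  refine mul_le_of_le_one_left (norm_nonneg _) ?_
  rw [← div_eq_mul_inv, div_le_one (Real.sqrt_pos.2 (weight_pos hω ξ))]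
  exact Real.le_sqrt_of_sq_le (hmw ξ)

/-- The isometry of `L²` onto the energy space. -/
def toEnergy {ω : ℝ} (hω : 0 < ω) (f : L2) : energySpace :=
  ⟨fullSynth hω f,
    fullSynth_mem_multiplierDomain hω f measurable_symbolDx fun ξ => by
      rw [weight_eq]; nlinarith [sq_nonneg ‖symbolHalfDy ξ‖],
    fullSynth_mem_multiplierDomain hω f measurable_symbolHalfDy fun ξ => by
      rw [weight_eq]; nlinarith [sq_nonneg ‖symbolDx ξ‖]⟩

theorem coe_toEnergy {ω : ℝ} (hω : 0 < ω) (f : L2) : (toEnergy hω f : L2) = fullSynth hω f := rfl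

/-- The preimage of `u` is `√(weight ω) · 𝓕 u`, square integrable because `√(weight ω) ≤ ‖symbolDx‖
+ ‖symbolHalfDy‖ + √ω`. -/
theorem toEnergy_surjective {ω : ℝ} (hω : 0 < ω) : Function.Surjective (toEnergy hω) := by
  intro u
  have h1 : MemLp (fun ξ => symbolDx ξ * (𝓕 (u : L2) : L2) ξ) 2 volume := u.2.1
  have h2 : MemLp (fun ξ => symbolHalfDy ξ * (𝓕 (u : L2) : L2) ξ) 2 volume := u.2.2
  have h3 := (Lp.memLp (𝓕 (u : L2) : L2)).norm.const_mul √ω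
  have h : MemLp (fun ξ => (√(weight ω ξ) : ℂ) * (𝓕 (u : L2) : L2) ξ) 2 volume := by
    refine ((h1.norm.add h2.norm).add h3).mono' ?_ (.of_forall fun ξ => ?_)
    · refine AEStronglyMeasurable.mul ?_ (Lp.aestronglyMeasurable _)
      have := continuous_weight ω
      exact Continuous.aestronglyMeasurable (by fun_prop)
    · simp only [Pi.add_apply, norm_mul, Complex.norm_real]
      rw [← add_mul, ← add_mul, Real.norm_of_nonneg (Real.sqrt_nonneg _)]
      gcongr
      rw [Real.sqrt_le_left (by positivity), weight_eq]
      have hs := Real.sq_sqrt hω.le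
      nlinarith [mul_nonneg (norm_nonneg (symbolDx ξ)) (norm_nonneg (symbolHalfDy ξ)),
        mul_nonneg (norm_nonneg (symbolDx ξ)) (Real.sqrt_nonneg ω),
        mul_nonneg (norm_nonneg (symbolHalfDy ξ)) (Real.sqrt_nonneg ω)]
  refine ⟨h.toLp, Subtype.ext ?_⟩
  rw [coe_toEnergy]
  have h4 : (𝓕 (fullSynth hω h.toLp) : L2) = 𝓕 (u : L2) := by
    apply Lp.ext
    filter_upwards [fourier_fullSynth hω h.toLp, h.coeFn_toLp] with ξ h5 h6
    rw [h5, h6, ← mul_assoc, ← Complex.ofReal_mul,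
      inv_mul_cancel₀ (Real.sqrt_pos.2 (weight_pos hω ξ)).ne', Complex.ofReal_one, one_mul]
  exact (Lp.fourierTransformₗᵢ Plane ℂ).injective h4

theorem toEnergy_eq_zero_iff {ω : ℝ} (hω : 0 < ω) (f : L2) : toEnergy hω f = 0 ↔ f = 0 := by
  refine ⟨fun h => fullSynth_injective hω (congrArg Subtype.val h), ?_⟩
  rintro rfl
  exact Subtype.ext (map_zero (fullSynth hω))

theorem inner_fourierInv (f g : L2) : inner ℂ (𝓕⁻ f : L2) (𝓕⁻ g : L2) = inner ℂ f g :=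
  (Lp.fourierTransformₗᵢ Plane ℂ).symm.inner_map_map f g

/-- Plancherel. The integrability is recorded so that the three integrals of the energy product can
be added. -/
theorem inner_multiplier {m : Plane → ℂ} (u v : multiplierDomain m) :
    Integrable (fun ξ => ((‖m ξ‖ ^ 2 : ℝ) : ℂ) *
      ((𝓕 (v : L2) : L2) ξ * conj ((𝓕 (u : L2) : L2) ξ))) ∧
    inner ℂ (multiplier m u) (multiplier m v) =
      ∫ ξ, ((‖m ξ‖ ^ 2 : ℝ) : ℂ) * ((𝓕 (v : L2) : L2) ξ * conj ((𝓕 (u : L2) : L2) ξ)) := by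
  have hu : MemLp (fun ξ => m ξ * (𝓕 (u : L2) : L2) ξ) 2 volume := u.2
  have hv : MemLp (fun ξ => m ξ * (𝓕 (v : L2) : L2) ξ) 2 volume := v.2
  have hae : (fun ξ => inner ℂ (hu.toLp _ ξ) (hv.toLp _ ξ)) =ᵐ[volume] fun ξ =>
      ((‖m ξ‖ ^ 2 : ℝ) : ℂ) * ((𝓕 (v : L2) : L2) ξ * conj ((𝓕 (u : L2) : L2) ξ)) := by
    filter_upwards [hu.coeFn_toLp, hv.coeFn_toLp] with ξ h1 h2
    rw [h1, h2, RCLike.inner_apply, map_mul, Complex.ofReal_pow, ← Complex.mul_conj']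
    ring
  refine ⟨(L2.integrable_inner _ _).congr hae, ?_⟩
  rw [multiplier, multiplier, inner_fourierInv, L2.inner_def]
  exact integral_congr_ae hae

/-- The energy scalar product is transported to the scalar product of `L²`. -/
theorem inner_toEnergy {ω : ℝ} (hω : 0 < ω) (f g : L2) :
    inner ℂ (dx (toEnergy hω f)) (dx (toEnergy hω g)) +
      inner ℂ (halfDy (toEnergy hω f)) (halfDy (toEnergy hω g)) +
      ω * inner ℂ (toEnergy hω f : L2) (toEnergy hω g : L2) = inner ℂ f g := by
  set u := toEnergy hω f with hu
  set v := toEnergy hω g with hv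
  obtain ⟨i1, e1⟩ := inner_multiplier (⟨u, u.2.1⟩ : multiplierDomain symbolDx) ⟨v, v.2.1⟩
  obtain ⟨i2, e2⟩ := inner_multiplier (⟨u, u.2.2⟩ : multiplierDomain symbolHalfDy) ⟨v, v.2.2⟩
  have e3 : inner ℂ (u : L2) (v : L2) =
      ∫ ξ, (𝓕 (v : L2) : L2) ξ * conj ((𝓕 (u : L2) : L2) ξ) := by
    rw [← Lp.inner_fourier_eq, L2.inner_def]
    rfl
  have i3 : Integrable fun ξ => (𝓕 (v : L2) : L2) ξ * conj ((𝓕 (u : L2) : L2) ξ) :=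
    L2.integrable_inner (𝕜 := ℂ) (𝓕 (u : L2) : L2) (𝓕 (v : L2) : L2)
  rw [dx, dx, halfDy, halfDy, e1, e2, e3, ← integral_const_mul, ← integral_add i1 i2]
  have i12 := i1.add i2
  simp only [Pi.add_def] at i12
  rw [← integral_add i12 (i3.const_mul _), L2.inner_def]
  refine integral_congr_ae ?_
  filter_upwards [fourier_fullSynth hω f, fourier_fullSynth hω g] with ξ h1 h2
  rw [hu, hv, coe_toEnergy, coe_toEnergy, h1, h2, RCLike.inner_apply, map_mul, Complex.conj_ofReal]
  have hw := weight_eq ω ξ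
  have hs : (√(weight ω ξ))⁻¹ * (√(weight ω ξ))⁻¹ * weight ω ξ = 1 := by
    have h0 := weight_pos hω ξ
    rw [← mul_inv, Real.mul_self_sqrt h0.le, inv_mul_cancel₀ h0.ne']
  have hs' : (((√(weight ω ξ))⁻¹ : ℝ) : ℂ) * (((√(weight ω ξ))⁻¹ : ℝ) : ℂ) *
      (((‖symbolDx ξ‖ ^ 2 : ℝ) : ℂ) + ((‖symbolHalfDy ξ‖ ^ 2 : ℝ) : ℂ) + (ω : ℂ)) = 1 := by
    -- The third occurrence of the weight is the one outside the square roots.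
    nth_rewrite 3 [hw] at hs
    exact_mod_cast hs
  linear_combination (g ξ * conj (f ξ)) * hs'

theorem normSq_toEnergy {ω : ℝ} (hω : 0 < ω) (f : L2) :
    ‖dx (toEnergy hω f)‖ ^ 2 + ‖halfDy (toEnergy hω f)‖ ^ 2 + ω * ‖(toEnergy hω f : L2)‖ ^ 2 =
      ‖f‖ ^ 2 := by
  have h := inner_toEnergy hω f f
  simp only [inner_self_eq_norm_sq_to_K] at h
  apply Complex.ofReal_injective
  push_cast
  exact h

theorem potential_toEnergy {ω : ℝ} (hω : 0 < ω) (p : ℝ) (f : L2) :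
    potential p (toEnergy hω f) = power hω (p + 1) f := rfl

theorem nehari_toEnergy {ω : ℝ} (hω : 0 < ω) (p : ℝ) (f : L2) :
    nehari p ω (toEnergy hω f) = ‖f‖ ^ 2 - power hω (p + 1) f := by
  rw [nehari, normSq_toEnergy, potential_toEnergy]

theorem action_toEnergy {ω : ℝ} (hω : 0 < ω) (p : ℝ) (f : L2) :
    action p ω (toEnergy hω f) = 1 / 2 * ‖f‖ ^ 2 - 1 / (p + 1) * power hω (p + 1) f := by
  rw [action, ← normSq_toEnergy hω f, potential_toEnergy]
  ring

/-! ### The Euler–Lagrange equation -/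

/-- Convexity of `z ↦ |z|^q`. -/
theorem rpow_norm_add_ge {q : ℝ} (hq : 1 ≤ q) (a b : ℂ) :
    ‖a‖ ^ q + q * (((‖a‖ ^ (q - 2) : ℝ) : ℂ) * a * conj b).re ≤ ‖a + b‖ ^ q := by
  by_cases ha : a = 0
  · have : q ≠ 0 := by linarith
    simp only [ha, norm_zero, Real.zero_rpow this, mul_zero, zero_mul, Complex.zero_re, zero_add]
    positivity
  have hn : 0 < ‖a‖ := norm_pos_iff.2 ha
  have hre : (((‖a‖ ^ (q - 2) : ℝ) : ℂ) * a * conj b).re = ‖a‖ ^ (q - 2) * (a * conj b).re := by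
    rw [mul_assoc, Complex.re_ofReal_mul]
  have h1 : (a * conj b).re ≤ ‖a‖ * (‖a + b‖ - ‖a‖) := by
    have h2 : (a * conj (a + b)).re ≤ ‖a‖ * ‖a + b‖ := by
      refine (Complex.re_le_norm _).trans_eq ?_
      rw [norm_mul, RCLike.norm_conj]
    have h3 : (a * conj a).re = ‖a‖ * ‖a‖ := by
      rw [Complex.mul_conj, Complex.ofReal_re, Complex.normSq_eq_norm_sq, sq]
    rw [map_add, mul_add, Complex.add_re, h3] at h2
    linarith
  -- Bernoulli's inequality for the ratio `‖a + b‖ / ‖a‖`.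
  have hb := one_add_mul_self_le_rpow_one_add
    (show -1 ≤ ‖a + b‖ / ‖a‖ - 1 by linarith [div_nonneg (norm_nonneg (a + b)) hn.le]) hq
  rw [add_sub_cancel, Real.div_rpow (norm_nonneg _) hn.le, le_div_iff₀ (by positivity)] at hb
  refine le_trans ?_ hb
  rw [hre]
  have h4 : ‖a‖ ^ q = ‖a‖ ^ (q - 2) * ‖a‖ * ‖a‖ := by
    rw [Real.rpow_sub hn, Real.rpow_two]
    field_simp
  have h5 : ‖a‖ ^ (q - 2) * (a * conj b).re ≤
      ‖a‖ ^ (q - 2) * (‖a‖ * (‖a + b‖ - ‖a‖)) := by gcongr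
  calc _ ≤ ‖a‖ ^ q + q * (‖a‖ ^ (q - 2) * (‖a‖ * (‖a + b‖ - ‖a‖))) := by gcongr
    _ = _ := by
      rw [h4]
      field_simp

/-- The integrand of the derivative of the potential energy. -/
def nonlinearity {ω : ℝ} (hω : 0 < ω) (q : ℝ) (g h : L2) (z : Plane) : ℂ :=
  ((‖fullSynth hω g z‖ ^ (q - 2) : ℝ) : ℂ) * fullSynth hω g z * conj (fullSynth hω h z)

theorem integrable_nonlinearity {ω : ℝ} (hω : 0 < ω) {q : ℝ} (hq : 2 ≤ q) (hq6 : q < 6)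
    (g h : L2) : Integrable (nonlinearity hω q g h) := by
  have hg := Lp.aestronglyMeasurable (fullSynth hω g)
  have hh := Lp.aestronglyMeasurable (fullSynth hω h)
  refine ((integrable_norm_rpow_fullSynth hω hq hq6 g).add
    (integrable_norm_rpow_fullSynth hω hq hq6 h)).mono' ?_ (.of_forall fun z => ?_)
  · refine AEStronglyMeasurable.mul (AEStronglyMeasurable.mul ?_ hg)
      (Complex.continuous_conj.comp_aestronglyMeasurable hh)
    exact Complex.continuous_ofReal.comp_aestronglyMeasurable
      ((hg.norm.aemeasurable.pow_const _).aestronglyMeasurable)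
  · simp only [nonlinearity, Pi.add_apply, norm_mul, RCLike.norm_conj, Complex.norm_real]
    rw [Real.norm_of_nonneg (by positivity)]
    set x := ‖fullSynth hω g z‖
    set y := ‖fullSynth hω h z‖
    have hx : 0 ≤ x := norm_nonneg _
    have hy : 0 ≤ y := norm_nonneg _
    have key : ∀ t : ℝ, 0 ≤ t → t ^ (q - 2) * t * t = t ^ q := by
      intro t ht
      rw [mul_assoc, ← sq, ← Real.rpow_natCast, ← Real.rpow_add_of_nonneg ht (by linarith)
        (by positivity)]
      congr 1
      push_cast; ring
    have hq2 : 0 ≤ q - 2 := by linarith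
    rcases le_total x y with hxy | hxy
    · calc x ^ (q - 2) * x * y ≤ y ^ (q - 2) * y * y := by gcongr
        _ = y ^ q := key y hy
        _ ≤ _ := le_add_of_nonneg_left (by positivity)
    · calc x ^ (q - 2) * x * y ≤ x ^ (q - 2) * x * x := by gcongr
        _ = x ^ q := key x hx
        _ ≤ _ := le_add_of_nonneg_right (by positivity)

theorem integral_nonlinearity_smul {ω : ℝ} (hω : 0 < ω) (q : ℝ) (g h : L2) (c : ℂ) :
    ∫ z, nonlinearity hω q g (c • h) z = conj c * ∫ z, nonlinearity hω q g h z := by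
  rw [← integral_const_mul]
  refine integral_congr_ae ?_
  filter_upwards [Lp.coeFn_smul c (fullSynth hω h)] with z hz
  rw [nonlinearity, nonlinearity, map_smul, hz, Pi.smul_apply, smul_eq_mul, map_mul]
  ring

theorem integral_nonlinearity_self {ω : ℝ} (hω : 0 < ω) {q : ℝ} (hq : 2 ≤ q) (g : L2) :
    ∫ z, nonlinearity hω q g g z = power hω q g := by
  rw [power, ← integral_complex_ofReal]
  congr 1
  ext1 z
  rw [nonlinearity, mul_assoc, Complex.mul_conj, Complex.normSq_eq_norm_sq, ← Complex.ofReal_mul,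
    ← Real.rpow_natCast, ← Real.rpow_add_of_nonneg (norm_nonneg _) (by linarith) (by positivity)]
  congr 2
  push_cast; ring

/-- The pointwise convexity inequality, integrated. This one-sided tangent bound replaces
differentiation of `power` under the integral. -/
theorem power_add_ge {ω : ℝ} (hω : 0 < ω) {q : ℝ} (hq : 2 ≤ q) (hq6 : q < 6) (g h : L2) :
    power hω q g + q * (∫ z, nonlinearity hω q g h z).re ≤ power hω q (g + h) := by
  have hi := integrable_nonlinearity hω hq hq6 g h
  have h1 : (∫ z, nonlinearity hω q g h z).re = ∫ z, (nonlinearity hω q g h z).re :=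
    (Complex.reCLM.integral_comp_comm hi).symm
  have hire : Integrable fun z => (nonlinearity hω q g h z).re := hi.re
  rw [h1, power, power, ← integral_const_mul, ← integral_add
    (integrable_norm_rpow_fullSynth hω hq hq6 g) (hire.const_mul q)]
  refine integral_mono_ae ((integrable_norm_rpow_fullSynth hω hq hq6 g).add (hire.const_mul q))
    (integrable_norm_rpow_fullSynth hω hq hq6 (g + h)) ?_
  filter_upwards [Lp.coeFn_add (fullSynth hω g) (fullSynth hω h)] with z hz
  rw [map_add, hz, Pi.add_apply]
  exact rpow_norm_add_ge (by linarith) _ _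

/-- Normalised extremizers of the embedding satisfy the Euler–Lagrange equation. -/
theorem inner_eq_integral_nonlinearity {ω : ℝ} (hω : 0 < ω) {q : ℝ} (hq : 2 ≤ q) (hq6 : q < 6)
    {M : ℝ} {g : L2} (hg : g ≠ 0) (hM : ∀ f, power hω q f ≤ M * ‖f‖ ^ q)
    (hgM : power hω q g = M * ‖g‖ ^ q) (hnorm : M * ‖g‖ ^ (q - 2) = 1) (h : L2) :
    inner ℂ h g = ∫ z, nonlinearity hω q g h z := by
  have hn : 0 < ‖g‖ := norm_pos_iff.2 hg
  have hre : ∀ h : L2, (inner ℂ h g).re = (∫ z, nonlinearity hω q g h z).re := by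
    intro h
    set A := (∫ z, nonlinearity hω q g h z).re
    set B := (inner ℂ h g).re
    let N : ℝ → ℝ := fun t => ‖g‖ ^ 2 + 2 * t * B + t ^ 2 * ‖h‖ ^ 2
    have hN : ∀ t : ℝ, ‖g + (t : ℂ) • h‖ ^ 2 = N t := by
      intro t
      rw [norm_add_sq (𝕜 := ℂ), inner_smul_right, norm_smul, mul_pow, Complex.norm_real,
        Real.norm_eq_abs, sq_abs]
      have h1 : RCLike.re ((t : ℂ) * inner ℂ g h) = t * B := by
        have h2 : (inner ℂ g h).re = B := inner_re_symm (𝕜 := ℂ) g h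
        rw [← h2]
        exact Complex.re_ofReal_mul _ _
      rw [h1]
      ring
    -- The gap between `M ‖g + t h‖^q` and the tangent line to `power` at `g`. It is nonnegative and
    -- vanishes at `t = 0`, so its derivative `q (M ‖g‖^(q-2) B - A)` there is zero.
    let F : ℝ → ℝ := fun t => M * N t ^ (q / 2) - power hω q g - t * (q * A)
    have hF0 : F 0 = 0 := by
      have h1 : (‖g‖ ^ 2) ^ (q / 2) = ‖g‖ ^ q := by
        rw [← Real.rpow_natCast, ← Real.rpow_mul hn.le]
        congr 1; push_cast; ring
      simp [F, N, h1, hgM]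
    have hF : ∀ t, 0 ≤ F t := by
      intro t
      have h1 := power_add_ge hω hq hq6 g ((t : ℂ) • h)
      rw [integral_nonlinearity_smul, Complex.conj_ofReal, Complex.re_ofReal_mul] at h1
      have h2 := hM (g + (t : ℂ) • h)
      have h3 : ‖g + (t : ℂ) • h‖ ^ q = N t ^ (q / 2) := by
        rw [← hN, ← Real.rpow_natCast, ← Real.rpow_mul (norm_nonneg _)]
        congr 1; push_cast; ring
      rw [h3] at h2
      simp only [F]
      linarith
    have hmin : IsLocalMin F 0 := .of_forall fun t => by rw [hF0]; exact hF t
    have hNd : HasDerivAt N (2 * B) 0 := by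
      have h1 := (((hasDerivAt_id (0 : ℝ)).const_mul 2).mul_const B).const_add (‖g‖ ^ 2)
      have h2 := (hasDerivAt_pow 2 (0 : ℝ)).mul_const (‖h‖ ^ 2)
      simpa [N] using! h1.add h2
    have hN0 : N 0 = ‖g‖ ^ 2 := by simp [N]
    have hFd := (((hNd.rpow_const (p := q / 2) (Or.inl (by rw [hN0]; positivity))).const_mul
      M).sub_const (power hω q g)).sub ((hasDerivAt_id (0 : ℝ)).mul_const (q * A))
    have h0 := hmin.hasDerivAt_eq_zero hFd
    have h1 : (‖g‖ ^ 2) ^ (q / 2 - 1) = ‖g‖ ^ (q - 2) := by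
      rw [← Real.rpow_natCast, ← Real.rpow_mul hn.le]
      congr 1; push_cast; ring
    rw [hN0, h1] at h0
    have h2 : q * (B - A) = 0 := by linear_combination h0 - q * B * hnorm
    have hq0 : q ≠ 0 := by linarith
    have := (mul_eq_zero.1 h2).resolve_left hq0
    linarith
  apply Complex.ext (hre h)
  -- Both sides are conjugate-linear in `h`, so the real part at `i h` is the imaginary part at `h`.
  have h1 := hre (Complex.I • h)
  rw [inner_smul_left, integral_nonlinearity_smul, Complex.conj_I] at h1
  simpa using h1

theorem isSolution_toEnergy_iff {ω : ℝ} (hω : 0 < ω) (p : ℝ) (g : L2) :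
    IsSolution p ω (toEnergy hω g) ↔
      ∀ h : L2, inner ℂ h g = ∫ z, nonlinearity hω (p + 1) g h z := by
  rw [IsSolution, (toEnergy_surjective hω).forall]
  refine forall_congr' fun h => ?_
  rw [inner_toEnergy, sub_eq_zero]
  simp only [nonlinearity, coe_toEnergy, show p + 1 - 2 = p - 1 by ring]

end HalfWave

end

/-! ### The ground state as a rescaled extremizer -/

theorem mainTheorem2 (p ω : ℝ) (hp : 1 < p) (hp' : p < 5) (hω : 0 < ω) :
    (∀ u : HalfWave.energySpace,
      MemLp ((u : HalfWave.L2) : HalfWave.Plane → ℂ) (ENNReal.ofReal (p + 1)) volume) ∧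
    ∃ Q : HalfWave.energySpace,
      HalfWave.IsGroundState p ω Q ∧
      Q ∈ HalfWave.nehariManifold p ω ∧
      IsMinOn (HalfWave.action p ω) (HalfWave.nehariManifold p ω) Q ∧
      HalfWave.action p ω Q = HalfWave.minLevel p ω := by
  open HalfWave in
  have hq : 2 < p + 1 := by linarith
  have hq6 : p + 1 < 6 := by linarith
  refine ⟨(toEnergy_surjective hω).forall.2 fun f => memLp_fullSynth hω hq.le hq6 f, ?_⟩
  obtain ⟨M, hM, g₀, hg₀, hg₀M, hall⟩ := exists_extremizer hω hq hq6
  have hn₀ : 0 < ‖g₀‖ := norm_pos_iff.2 hg₀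
  -- The norm `r` that solves `M r^(p-1) = 1`.
  set r : ℝ := M ^ (-(p - 1)⁻¹) with hr
  have hr0 : 0 < r := by positivity
  set c : ℂ := ((r / ‖g₀‖ : ℝ) : ℂ) with hc
  have hcn : ‖c‖ = r / ‖g₀‖ := by
    rw [hc, Complex.norm_real, Real.norm_of_nonneg (by positivity)]
  set g : L2 := c • g₀ with hg
  have hgn : ‖g‖ = r := by rw [hg, norm_smul, hcn, div_mul_cancel₀ _ hn₀.ne']
  have hgne : g ≠ 0 := norm_pos_iff.1 (by rwa [hgn])
  have hgM : power hω (p + 1) g = M * ‖g‖ ^ (p + 1) := by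
    rw [hg, power_smul, hg₀M, norm_smul, Real.mul_rpow (norm_nonneg _) (norm_nonneg _)]
    ring
  have hnorm : M * ‖g‖ ^ (p + 1 - 2) = 1 := by
    have hp1 : p - 1 ≠ 0 := by linarith
    rw [hgn, hr, ← Real.rpow_mul hM.le, show -(p - 1)⁻¹ * (p + 1 - 2) = -1 by
      rw [show p + 1 - 2 = p - 1 by ring, neg_mul, inv_mul_cancel₀ hp1], Real.rpow_neg_one,
      mul_inv_cancel₀ hM.ne']
  have hsplit : ∀ t : ℝ, 0 < t → t ^ (p + 1) = t ^ (p + 1 - 2) * t ^ 2 := fun t ht => by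
    rw [← Real.rpow_natCast, ← Real.rpow_add ht]
    congr 1
    push_cast
    ring
  have hgpow : power hω (p + 1) g = ‖g‖ ^ 2 := by
    rw [hgM, hsplit _ (norm_pos_iff.2 hgne), ← mul_assoc, hnorm, one_mul]
  have hmem : toEnergy hω g ∈ nehariManifold p ω :=
    ⟨fun h => hgne ((toEnergy_eq_zero_iff hω g).1 h), by rw [nehari_toEnergy, hgpow, sub_self]⟩
  have hsol : IsSolution p ω (toEnergy hω g) :=
    (isSolution_toEnergy_iff hω p g).2
      (inner_eq_integral_nonlinearity hω hq.le hq6 hgne hall hgM hnorm)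
  have hmin : ∀ u ∈ nehariManifold p ω, action p ω (toEnergy hω g) ≤ action p ω u := by
    rw [(toEnergy_surjective hω).forall]
    rintro f ⟨hf0, hfN⟩
    have hfne : f ≠ 0 := fun h => hf0 ((toEnergy_eq_zero_iff hω f).2 h)
    have hfn : 0 < ‖f‖ := norm_pos_iff.2 hfne
    rw [nehari_toEnergy, sub_eq_zero] at hfN
    -- On the Nehari manifold the action equals `(1/2 - 1/(p+1)) ‖f‖²`, so only norms are compared.
    rw [action_toEnergy, action_toEnergy, ← hfN, hgpow]
    -- There the sharp inequality reads `‖f‖² ≤ M ‖f‖^(p+1)`, that is `1 ≤ M ‖f‖^(p-1)`, with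
    -- equality at `g`.
    have h1 := hall f
    rw [← hfN, hsplit _ hfn, ← mul_assoc] at h1
    have h2 : M * ‖g‖ ^ (p + 1 - 2) ≤ M * ‖f‖ ^ (p + 1 - 2) := by
      rw [hnorm]
      exact le_of_mul_le_mul_right (by rwa [one_mul]) (by positivity : 0 < ‖f‖ ^ 2)
    have h3 : ‖g‖ ≤ ‖f‖ :=
      (Real.rpow_le_rpow_iff (norm_nonneg _) (norm_nonneg _) (by linarith)).1
        (le_of_mul_le_mul_left h2 hM)
    have h4 : 0 ≤ 1 / 2 - 1 / (p + 1) := by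
      rw [sub_nonneg]
      exact one_div_le_one_div_of_le two_pos hq.le
    have h5 : ‖g‖ ^ 2 ≤ ‖f‖ ^ 2 := by gcongr
    nlinarith [mul_le_mul_of_nonneg_left h5 h4]
  refine ⟨toEnergy hω g, ⟨⟨hmem.1, hsol⟩, fun u hu hus => hmin u ⟨hu, ?_⟩⟩, hmem, hmin, ?_⟩
  · obtain ⟨f, rfl⟩ := toEnergy_surjective hω u
    -- Testing the equation against the solution itself places it on the Nehari manifold.
    have h1 := (isSolution_toEnergy_iff hω p f).1 hus f
    rw [integral_nonlinearity_self hω hq.le, inner_self_eq_norm_sq_to_K] at h1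
    have h2 : ‖f‖ ^ 2 = power hω (p + 1) f := by
      apply Complex.ofReal_injective
      push_cast
      exact h1
    rw [nehari_toEnergy, h2, sub_self]
  · have hleast : IsLeast (action p ω '' nehariManifold p ω) (action p ω (toEnergy hω g)) :=
      ⟨⟨_, hmem, rfl⟩, by
        rintro _ ⟨u, hu, rfl⟩
        exact hmin u hu⟩
    exact hleast.csInf_eq.symm
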